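/- **Setting.** Let $H$ be a real separable Hilbert space with orthonormal basis $(e_k)_{k\ge1}$, let $1\le p<\alpha$ with $\alpha\in(1,2)$, and let $(\Omega,\mathcal F,(\mathcal F_t)_{t\ge0},\mathbb P)$ be a filtered probability space. Assume: 1. $A:\mathscr D(A)\subset H\to H$ is a self-adjoint operator generating a strongly continuous semigroup $(e^{tA})_{t\ge0}$, with $e_k\in\mathscr D(A)$ and $Ae_k=-\lambda_ke_k$, where $\lambda_k>0$ and $\lambda_k\uparrow\infty$. 2. $B:H\times\mathscr P_p\to H$, where $\mathscr P_p$ is the set of Borel probability measures on $H$ with finite $p$-th moment, and for some $C>0$ $$|B(x,\mu)-B(y,\nu)|\le C\big[|x-y|+\mathbb W_p(\mu,\nu)\big]\qquad\text{for all }x,y\in H,\ \mu,\nu\in\mathscr P_p,$$ where $\mathbb W_p(\mu,\nu)=\inf_\pi\big(\int|x-y|^p\,\pi(dx,dy)\big)^{1/p}$ is the $L^p$-Wasserstein distance, the infimum being over all couplings $\pi$ of $\mu$ and $\nu$. 3. $\beta_k>0$ for all $k$ and $\sum_k\beta_k^\alpha/\lambda_k<\infty$. 4. $L_t=\sum_k\beta_kL^k_te_k$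 is a cylindrical $\alpha$-stable process: the $L^k$ are independent, $(\mathcal F_t)$-adapted real Lévy processes with $\mathbb E[e^{ihL^k_t}]=e^{-t|h|^\alpha}$ for $h\in\mathbb R$, $t\ge 0$. For an $\mathcal F_0$-measurable $\xi:\Omega\to H$ consider $$dX_t=AX_t\,dt+B(X_t,\mathscr L_{X_t})\,dt+dL_t,\qquad X_0=\xi, \tag{1}$$ where $\mathscr L_{X_t}$ is the law of $X_t$. A *mild solution* of (1) is an $H$-valued predictable, $(\mathcal F_t)$-adapted process $(X_t)_{t\ge0}$ such that $\mathbb E|X_t|^p<\infty$ for every $t\ge0$ (so that $\mathscr L_{X_t}\in\mathscr P_p$) and, for every $t\ge0$, $\mathbb P$-almost surely $\int_0^t|e^{(t-s)A}B(X_s,\mathscr L_{X_s})|\,ds<\infty$ and $$X_t=e^{tA}\xi+\int_0^te^{(t-s)A}B(X_s,\mathscr L_{X_s})\,ds+\int_0^te^{(t-s)A}\,dL_s,$$ where $\int_0^te^{(t-s)A}dL_s=\sum_k\beta_k\big(\int_0^te^{-\lambda_k(t-s)}dL^k_s\big)e_k$. Let $\mathcal K$ be the class of processes $X$ with $\int_0^T(\mathbb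 E|X_s|^p)^{1/p}\,ds<\infty$ for all $T>0$. **Theorem.** Under these assumptions: (i) For every $\mathcal F_0$-measurable $\xi$ with $\mathbb E|\xi|^p<\infty$, equation (1) has a mild solution in $\mathcal K$, and it is unique in $\mathcal K$: if $X,Y\in\mathcal K$ are mild solutions of (1), then $X_t=Y_t$ $\mathbb P$-almost surely for every $t\ge0$. (ii) For every $m\in[p,\alpha)$ and $T>0$ there is a constant $C_{T,m}>0$, not depending on $\xi$, such that for every $\mathcal F_0$-measurable $\xi$ with $\mathbb E|\xi|^m<\infty$ the mild solution $X\in\mathcal K$ of (1) satisfies $$\sup_{t\in[0,T]}\big(\mathbb E|X_t|^m\big)^{1/m}\le C_{T,m}\Big[1+\big(\mathbb E|\xi|^m\big)^{1/m}\Big].$$ -/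

import Mathlib

open MeasureTheory ProbabilityTheory Filter Topology Set
open scoped NNReal ENNReal

noncomputable section

namespace McKeanVlasov

/-! ### Probability measures with finite `p`-th moment and the Wasserstein distance -/

section Wasserstein

variable {H : Type*} [NormedAddCommGroup H] [MeasurableSpace H]

/-- The space of Borel probability measures on `H` with finite `p`-th moment. -/
def FiniteMomentMeasure (H : Type*) [NormedAddCommGroup H] [MeasurableSpace H] (p : ℝ) : Type _ :=
  {μ : ProbabilityMeasure H // ∫⁻ x, ‖x‖ₑ ^ p ∂(μ : Measure H) < ∞}

/-- `π` is a coupling of `μ` and `ν`: a measure on `H × H` with marginals `μ` and `ν`. -/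
def IsCoupling (π : Measure (H × H)) (μ ν : Measure H) : Prop :=
  π.map Prod.fst = μ ∧ π.map Prod.snd = ν

/-- The `L^p`-Wasserstein distance on measures of finite `p`-th moment (as an extended
nonnegative number; it is finite for `p ≥ 1`). -/
def wasserstein {p : ℝ} (μ ν : FiniteMomentMeasure H p) : ℝ≥0∞ :=
  ⨅ (π : Measure (H × H)) (_ : IsCoupling π (μ.1 : Measure H) (ν.1 : Measure H)),
    (∫⁻ z, ‖z.1 - z.2‖ₑ ^ p ∂π) ^ (1 / p)

/-- The law of a random variable with finite `p`-th moment. -/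
def lawOf {Ω : Type*} [MeasurableSpace Ω] {P : Measure Ω} [IsProbabilityMeasure P] [BorelSpace H]
    {p : ℝ} (X : Ω → H) (hm : AEMeasurable X P) (hX : ∫⁻ ω, ‖X ω‖ₑ ^ p ∂P < ∞) :
    FiniteMomentMeasure H p :=
  ⟨⟨P.map X, Measure.isProbabilityMeasure_map hm⟩, by
    change ∫⁻ x, ‖x‖ₑ ^ p ∂(P.map X) < ∞
    rw [lintegral_map' (by fun_prop) hm]
    exact hX⟩

end Wasserstein

/-! ### The semigroup generated by an unbounded operator -/

/-- `S` is the strongly continuous semigroup `(e^{tA})_{t ≥ 0}`, i.e. the `C₀`-semigroup whose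
infinitesimal generator (with its full domain) is `A`. -/
structure IsSemigroupGeneratedBy {H : Type*} [NormedAddCommGroup H] [NormedSpace ℝ H]
    (S : ℝ≥0 → H →L[ℝ] H) (A : H →ₗ.[ℝ] H) : Prop where
  map_zero : S 0 = ContinuousLinearMap.id ℝ H
  map_add : ∀ s t, S (s + t) = (S s).comp (S t)
  continuous : ∀ x, Continuous fun t => S t x
  generator : ∀ x y, (x, y) ∈ A.graph ↔
    Tendsto (fun t : ℝ≥0 => (t : ℝ)⁻¹ • (S t x - x)) (𝓝[>] 0) (𝓝 y)

/-! ### Cylindrical stable noise and stochastic convolutions -/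

section Noise

variable {Ω : Type*} [mΩ : MeasurableSpace Ω]

/-- A real-valued process `ℓ` is a standard symmetric `α`-stable (Lévy) process: it has
independent and stationary increments, almost surely càdlàg paths, and
`E[exp(i h ℓ_t)] = exp(-t |h|^α)` (so that `ℓ_0 = 0` almost surely). -/
structure IsSymmetricStable (α : ℝ) (ℓ : ℝ≥0 → Ω → ℝ) (P : Measure Ω) : Prop where
  measurable : ∀ t, Measurable (ℓ t)
  indep_increments : HasIndepIncrements ℓ P
  stationary_increments : ∀ s t, s ≤ t → IdentDistrib (ℓ t - ℓ s) (ℓ (t - s)) P P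
  cadlag : ∀ᵐ ω ∂P, ∀ t, ContinuousWithinAt (fun s => ℓ s ω) (Ici t) t ∧
    ∃ l, Tendsto (fun s => ℓ s ω) (𝓝[<] t) (𝓝 l)
  charFun_eq : ∀ t : ℝ≥0, ∀ h : ℝ,
    charFun (P.map (ℓ t)) h = (Real.exp (-(t : ℝ) * |h| ^ α) : ℂ)

/-- `I = ∫₀ᵗ f(s) dℓ_s` for a (continuous) deterministic `f`: `I` is the limit in probability of
the Riemann sums of `f` against the increments of `ℓ` over the partitions of `[0, t]` into `n`
equal parts. -/
def IsStochIntegral (P : Measure Ω) (f : ℝ≥0 → ℝ) (ℓ : ℝ≥0 → Ω → ℝ) (t : ℝ≥0) (I : Ω → ℝ) : Prop :=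
  TendstoInMeasure P
    (fun (n : ℕ) ω => ∑ i ∈ Finset.range n,
      f (t * i / n) * (ℓ (t * (i + 1) / n) ω - ℓ (t * i / n) ω)) atTop I

variable {H : Type*} [NormedAddCommGroup H] [InnerProductSpace ℝ H]

/-- `Z = ∫₀ᵗ e^{(t-s)A} dL_s` for `L = ∑ₖ βₖ Lᵏ eₖ` and `A eₖ = -λₖ eₖ`, i.e.
`Z = ∑ₖ βₖ (∫₀ᵗ e^{-λₖ(t-s)} dLᵏ_s) eₖ`, the series converging in `H` almost surely. -/
def IsStochConvolution (P : Measure Ω) (e : HilbertBasis ℕ ℝ H) (lam β : ℕ → ℝ)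
    (L : ℕ → ℝ≥0 → Ω → ℝ) (t : ℝ≥0) (Z : Ω → H) : Prop :=
  ∃ I : ℕ → Ω → ℝ,
    (∀ k, IsStochIntegral P (fun s => Real.exp (-lam k * ((t : ℝ) - s))) (L k) t (I k)) ∧
    ∀ᵐ ω ∂P, HasSum (fun k => (β k * I k ω) • e k) (Z ω)

/-- `L = ∑ₖ βₖ Lᵏ eₖ` is a cylindrical `α`-stable process on the filtered probability space, given
through its coordinates: the `Lᵏ` are adapted, independent, standard symmetric `α`-stable
processes. -/
structure IsCylindricalStable (α : ℝ) (𝓕 : Filtration ℝ≥0 mΩ)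
    (P : Measure Ω) (L : ℕ → ℝ≥0 → Ω → ℝ) : Prop where
  stable : ∀ k, IsSymmetricStable α (L k) P
  indep : iIndepFun (fun k ω t => L k t ω) P
  adapted : ∀ k, StronglyAdapted 𝓕 (L k)

end Noise

/-! ### Mild solutions -/

section Mild

variable {Ω H : Type*} [mΩ : MeasurableSpace Ω]
  [NormedAddCommGroup H] [InnerProductSpace ℝ H] [MeasurableSpace H] [BorelSpace H]

/-- `X` is a mild solution of `dX_t = A X_t dt + B(X_t, Law(X_t)) dt + dL_t`, `X_0 = ξ`, where
`S t = e^{tA}` and `A eₖ = -λₖ eₖ`. The moment condition is what makes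
`Law(X_t)` an element of the domain of `B`. -/
structure IsMildSolution (P : Measure Ω) [IsProbabilityMeasure P] (𝓕 : Filtration ℝ≥0 mΩ) (p : ℝ)
    (e : HilbertBasis ℕ ℝ H) (lam β : ℕ → ℝ) (L : ℕ → ℝ≥0 → Ω → ℝ)
    (S : ℝ≥0 → H →L[ℝ] H) (B : H → FiniteMomentMeasure H p → H) (ξ : Ω → H)
    (X : ℝ≥0 → Ω → H) : Prop where
  predictable : IsStronglyPredictable 𝓕 X
  adapted : StronglyAdapted 𝓕 X
  aemeasurable : ∀ t, AEMeasurable (X t) P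
  moment : ∀ t, ∫⁻ ω, ‖X t ω‖ₑ ^ p ∂P < ∞
  integrable : ∀ t : ℝ≥0, ∀ᵐ ω ∂P, IntervalIntegrable
    (fun s : ℝ => S (t - s.toNNReal) (B (X s.toNNReal ω)
      (lawOf (X s.toNNReal) (aemeasurable s.toNNReal) (moment s.toNNReal)))) volume 0 t
  equation : ∀ t : ℝ≥0, ∃ Z : Ω → H, IsStochConvolution P e lam β L t Z ∧
    ∀ᵐ ω ∂P, X t ω = S t (ξ ω) +
      (∫ s in (0 : ℝ)..t, S (t - s.toNNReal) (B (X s.toNNReal ω)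
        (lawOf (X s.toNNReal) (aemeasurable s.toNNReal) (moment s.toNNReal)))) + Z ω

/-- The function `s ↦ (E|X_s|^p)^{1/p}` is integrable on every interval `[0, T]`. -/
def HasIntegrableMoments (P : Measure Ω) (p : ℝ) (X : ℝ≥0 → Ω → H) : Prop :=
  ∀ T : ℝ≥0, ∫⁻ s in Icc (0 : ℝ) T, (∫⁻ ω, ‖X s.toNNReal ω‖ₑ ^ p ∂P) ^ (1 / p) < ∞

end Mild

end McKeanVlasov

end

/-!
The equation is solved in the Banach space `L^m(Ω; H)`, `p ≤ m < α`, where it becomes a semilinear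
Volterra equation with Lipschitz nonlinearity.

*The noise.* A symmetric `α`-stable variable of scale `s` has tails `P(|Y| > r) ≲ s r^{-α}`, read
off its characteristic function. For a vector with orthogonal stable coordinates of scales `s_k`,
truncate each coordinate at the level `r` and apply Markov's inequality to the sum of the
truncated squares: the tail of the norm is `≲ (∑ s_k) r^{-α}`, whence
`‖∑ Y_k v_k‖_{L^m} ≲ (∑ s_k)^{1/α}` (`eLpNorm_sum_smul_le`). Riemann sums of `∫₀ᵗ e^{-λ_k(t-s)}
    dL^k_s` are stable because
the increments are independent, of scale at most `1/(α λ_k)`. Differences of Riemann sums are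
stable too, so the sums converge in `L^m`, locally uniformly in `t`, and the series over `k`
converges in `L^m` uniformly in `t` because `∑ β_k^α/λ_k < ∞`. Thus the stochastic convolution is
a bounded continuous adapted curve in `L^m(Ω; H)` (`exists_stochConvolution`). The almost sure
convergence of the series along the basis is that of the orthogonal expansion of a vector of `H`.

*The drift.* The eigenbasis makes the semigroup contractive. The joint law of `X` and `Y` is a
coupling of their laws, so that `W_p(Law X, Law Y) ≤ ‖X - Y‖_{L^p}` and `X ↦ B(X, Law X)` is
Lipschitz on `L^m(Ω; H)`. Picard iteration gives a continuous solution curve in `L^m(Ω; H)`, which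
is adapted because the iteration preserves the closed subspaces of random variables measurable up
to time `t` (`exists_volterra_solution`). This curve has a predictable version
(`exists_predictable_version`), and Bochner integrals in `L^m` are given by integrals along paths
(`coeFn_integral_lp`), so the version is a mild solution (`exists_mildSolution`).

*Uniqueness and moments.* In the difference of two mild solutions the noise cancels. By
Minkowski's integral inequality `t ↦ (E|X_t - Y_t|^p)^{1/p}` satisfies a Grönwall inequality, and
membership in `𝒦` is the integrability which Grönwall's lemma needs (`IsMildSolution.ae_eq`). If
`E|ξ|^m < ∞`, the mild solution therefore coincides with the one constructed in `L^m(Ω; H)`, for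
which the moment bound is again Grönwall's inequality (`enorm_lp_solution_le`).
-/

namespace McKeanVlasov

/-! ### Moments of stable random variables and of stable random vectors -/

section StableMoments

variable {Ω : Type*} [mΩ : MeasurableSpace Ω] {P : Measure Ω}

lemma lintegral_Ioc_rpow {q b : ℝ} (hq : -1 < q) (hb : 0 ≤ b) :
    ∫⁻ t in Ioc 0 b, ENNReal.ofReal (t ^ q) = ENNReal.ofReal (b ^ (q + 1) / (q + 1)) := by
  rw [← ofReal_integral_eq_lintegral_ofReal, ← intervalIntegral.integral_of_le hb,
    integral_rpow (Or.inl hq), Real.zero_rpow (by linarith), sub_zero]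
  · exact (intervalIntegrable_iff_integrableOn_Ioc_of_le hb).1
      (intervalIntegral.intervalIntegrable_rpow' hq)
  · filter_upwards [ae_restrict_mem measurableSet_Ioc] with t ht
    exact Real.rpow_nonneg ht.1.le _

lemma lintegral_Ioi_rpow {q b : ℝ} (hq : q < -1) (hb : 0 < b) :
    ∫⁻ t in Ioi b, ENNReal.ofReal (t ^ q) = ENNReal.ofReal (-b ^ (q + 1) / (q + 1)) := by
  rw [← ofReal_integral_eq_lintegral_ofReal, integral_Ioi_rpow_of_lt hq hb]
  · exact integrableOn_Ioi_rpow_of_lt hq hb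
  · filter_upwards [ae_restrict_mem measurableSet_Ioi] with t ht
    exact Real.rpow_nonneg (hb.le.trans (le_of_lt ht)) _

/-- A weak `L^α` bound gives strong moments of every order `m < α`, with the right homogeneity. -/
lemma lintegral_rpow_le_of_tail [IsProbabilityMeasure P] {f : Ω → ℝ} (f_nn : ∀ ω, 0 ≤ f ω)
    (hf : AEMeasurable f P) {α m σ : ℝ} (hm : 0 < m) (hmα : m < α) (hσ : 0 < σ)
    (h : ∀ r, 0 < r → P {ω | r < f ω} ≤ ENNReal.ofReal (σ * r ^ (-α))) :
    ∫⁻ ω, ENNReal.ofReal (f ω ^ m) ∂P ≤ ENNReal.ofReal (α / (α - m) * σ ^ (m / α)) := by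
  have hα : 0 < α := hm.trans hmα
  rw [lintegral_rpow_eq_lintegral_meas_lt_mul P (ae_of_all _ f_nn) hf hm]
  -- the level below which the trivial bound `P ≤ 1` beats the tail bound
  set δ : ℝ := σ ^ (1 / α) with hδ
  have hδ0 : 0 < δ := Real.rpow_pos_of_pos hσ _
  have hδm : δ ^ m = σ ^ (m / α) := by
    rw [hδ, ← Real.rpow_mul hσ.le]; congr 1; field_simp
  have hδα : σ = δ ^ α := by
    rw [hδ, ← Real.rpow_mul hσ.le]; rw [one_div_mul_cancel hα.ne', Real.rpow_one]
  have hsplit : Ioi (0 : ℝ) = Ioc 0 δ ∪ Ioi δ := (Ioc_union_Ioi_eq_Ioi hδ0.le).symm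
  rw [hsplit, lintegral_union measurableSet_Ioi (Ioc_disjoint_Ioi le_rfl)]
  have h1 : ∫⁻ t in Ioc 0 δ, P {a | t < f a} * ENNReal.ofReal (t ^ (m - 1))
      ≤ ENNReal.ofReal (δ ^ m / m) := by
    have := lintegral_Ioc_rpow (q := m - 1) (by linarith) hδ0.le
    rw [sub_add_cancel] at this
    rw [← this]
    refine lintegral_mono fun t => ?_
    calc _ ≤ 1 * ENNReal.ofReal (t ^ (m - 1)) := by gcongr; exact prob_le_one
      _ = _ := one_mul _
  have h2 : ∫⁻ t in Ioi δ, P {a | t < f a} * ENNReal.ofReal (t ^ (m - 1))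
      ≤ ENNReal.ofReal (δ ^ m / (α - m)) := by
    have := lintegral_Ioi_rpow (q := m - 1 - α) (by linarith) hδ0
    calc _ ≤ ∫⁻ t in Ioi δ, ENNReal.ofReal σ * ENNReal.ofReal (t ^ (m - 1 - α)) := by
          refine setLIntegral_mono' measurableSet_Ioi fun t ht => ?_
          have ht0 : 0 < t := hδ0.trans ht
          calc _ ≤ ENNReal.ofReal (σ * t ^ (-α)) * ENNReal.ofReal (t ^ (m - 1)) := by
                gcongr; exact h t ht0
            _ = _ := by
              rw [← ENNReal.ofReal_mul (by positivity), ← ENNReal.ofReal_mul hσ.le, mul_assoc,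
                ← Real.rpow_add ht0]
              congr 3; ring
      _ = ENNReal.ofReal (δ ^ m / (α - m)) := by
          rw [lintegral_const_mul' _ _ ENNReal.ofReal_ne_top, this, ← ENNReal.ofReal_mul hσ.le]
          congr 1
          have : δ ^ m = δ ^ α * δ ^ (m - α) := by rw [← Real.rpow_add hδ0]; congr 1; ring
          have e : m - 1 - α + 1 = m - α := by ring
          have hne : m - α ≠ 0 := by linarith
          have hne' : α - m ≠ 0 := by linarith
          rw [e, this, hδα]
          nth_rewrite 2 [← hδα]
          rw [hδα]
          field_simp
          ring
  calc _ ≤ ENNReal.ofReal m * (ENNReal.ofReal (δ ^ m / m) + ENNReal.ofReal (δ ^ m / (α - m))) := by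
        gcongr
    _ = _ := by
      have : 0 < α - m := by linarith
      rw [← ENNReal.ofReal_add (by positivity) (by positivity), ← ENNReal.ofReal_mul hm.le, ← hδm]
      congr 1
      field_simp
      ring

/-- `Y` has the symmetric `α`-stable law with characteristic function `h ↦ exp(-s |h|^α)`. -/
structure IsStableVar (α s : ℝ) (Y : Ω → ℝ) (P : Measure Ω) : Prop where
  measurable : Measurable Y
  charFun_eq : ∀ h : ℝ, charFun (P.map Y) h = ((Real.exp (-(s * |h| ^ α)) : ℝ) : ℂ)

lemma IsStableVar.const_mul [IsProbabilityMeasure P] {α s : ℝ} {Y : Ω → ℝ}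
    (hY : IsStableVar α s Y P) (c : ℝ) :
    IsStableVar α (|c| ^ α * s) (fun ω => c * Y ω) P := by
  refine ⟨hY.measurable.const_mul c, fun h => ?_⟩
  have := charFun_map_mul_comp (μ := P) hY.measurable.aemeasurable c h
  rw [this, hY.charFun_eq, abs_mul, Real.mul_rpow (abs_nonneg _) (abs_nonneg _)]
  congr 3
  ring

/-- The tail is bounded by an average of `1 - charFun` over `[-2/r, 2/r]`. -/
lemma IsStableVar.tail_le [IsProbabilityMeasure P] {α s : ℝ} {Y : Ω → ℝ}
    (hY : IsStableVar α s Y P) (hs : 0 ≤ s) (hα : α ∈ Ioo 1 2) {r : ℝ} (hr : 0 < r) :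
    P {ω | r < |Y ω|} ≤ ENNReal.ofReal (8 * s * r ^ (-α)) := by
  have hprob : IsProbabilityMeasure (P.map Y) :=
    Measure.isProbabilityMeasure_map hY.measurable.aemeasurable
  have h1 := measureReal_abs_gt_le_integral_charFun (μ := P.map Y) hr
  have hmeas : MeasurableSet {x : ℝ | r < |x|} := measurableSet_lt measurable_const (by fun_prop)
  have h2 : P {ω | r < |Y ω|} = P.map Y {x | r < |x|} := by
    rw [Measure.map_apply hY.measurable hmeas]; rfl
  have h3 : ‖∫ t in (-2 * r⁻¹)..(2 * r⁻¹), 1 - charFun (P.map Y) t‖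
      ≤ s * (2 * r⁻¹) ^ α * |2 * r⁻¹ - -2 * r⁻¹| := by
    refine intervalIntegral.norm_integral_le_of_norm_le_const fun t ht => ?_
    have hr' : 0 < r⁻¹ := inv_pos.2 hr
    rw [uIoc_of_le (by linarith)] at ht
    have ht' : |t| ≤ 2 * r⁻¹ := abs_le.2 ⟨by linarith [ht.1], ht.2⟩
    have hx : 0 ≤ s * |t| ^ α := mul_nonneg hs (Real.rpow_nonneg (abs_nonneg _) _)
    rw [hY.charFun_eq, ← Complex.ofReal_one, ← Complex.ofReal_sub, Complex.norm_real,
      Real.norm_of_nonneg (by linarith [Real.exp_le_one_iff.2 (neg_nonpos.2 hx)])]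
    calc _ ≤ s * |t| ^ α := by linarith [Real.add_one_le_exp (-(s * |t| ^ α))]
      _ ≤ _ := by gcongr; linarith [hα.1]
  rw [h2, ← ofReal_measureReal]
  refine ENNReal.ofReal_le_ofReal (h1.trans ?_)
  calc _ ≤ 2⁻¹ * r * (s * (2 * r⁻¹) ^ α * |2 * r⁻¹ - -2 * r⁻¹|) := by gcongr
    _ = 2 * 2 ^ α * s * r ^ (-α) := by
      have hr' : 0 < r⁻¹ := inv_pos.2 hr
      rw [show 2 * r⁻¹ - -2 * r⁻¹ = 4 * r⁻¹ by ring, abs_of_pos (by positivity),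
        Real.mul_rpow (by norm_num) hr'.le, Real.inv_rpow hr.le, Real.rpow_neg hr.le]
      field_simp
      ring
    _ ≤ _ := by
      have : (2 : ℝ) ^ α ≤ 2 ^ (2 : ℝ) := Real.rpow_le_rpow_of_exponent_le (by norm_num) hα.2.le
      have h4 : (2 : ℝ) ^ (2 : ℝ) = 4 := by norm_num
      have : 2 * (2 : ℝ) ^ α ≤ 8 := by linarith
      gcongr

/-- The truncated second moment, from the layer-cake formula and the tail bound: this is where
`α < 2` enters. -/
lemma IsStableVar.lintegral_min_le [IsProbabilityMeasure P] {α s : ℝ} {Y : Ω → ℝ}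
    (hY : IsStableVar α s Y P) (hs : 0 ≤ s) (hα : α ∈ Ioo 1 2) {r : ℝ} (hr : 0 < r) :
    ∫⁻ ω, ENNReal.ofReal ((min 1 (|Y ω| / r)) ^ (2 : ℝ)) ∂P
      ≤ ENNReal.ofReal (16 / (2 - α) * s * r ^ (-α)) := by
  have hm : Measurable fun ω => min 1 (|Y ω| / r) :=
    measurable_const.min (hY.measurable.abs.div_const r)
  rw [lintegral_rpow_eq_lintegral_meas_lt_mul P
    (ae_of_all _ fun ω => le_min zero_le_one (by positivity)) hm.aemeasurable two_pos]
  have h2α : 0 < 2 - α := by linarith [hα.2]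
  have key : ∫⁻ t in Ioi (0 : ℝ), P {a | t < min 1 (|Y a| / r)} * ENNReal.ofReal (t ^ (2 - 1 : ℝ))
      ≤ ∫⁻ t in Ioc (0 : ℝ) 1, ENNReal.ofReal (8 * s * r ^ (-α)) * ENNReal.ofReal
          (t ^ (1 - α)) := by
    rw [← Ioc_union_Ioi_eq_Ioi (zero_le_one (α := ℝ)),
      lintegral_union measurableSet_Ioi (Ioc_disjoint_Ioi le_rfl)]
    have h0 : ∫⁻ t in Ioi (1 : ℝ), P {a | t < min 1 (|Y a| / r)} * ENNReal.ofReal (t ^ (2 - 1 : ℝ))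
        = 0 := by
      rw [setLIntegral_congr_fun (g := fun _ => 0) measurableSet_Ioi, lintegral_zero]
      intro t ht
      have : {a | t < min 1 (|Y a| / r)} = ∅ := by
        ext a
        simp only [mem_ofPred_eq, mem_empty_iff_false, iff_false, not_lt]
        exact (min_le_left _ _).trans (le_of_lt ht)
      simp only [this, measure_empty, zero_mul]
    rw [h0, add_zero]
    refine setLIntegral_mono' measurableSet_Ioc fun t ht => ?_
    have hsub : {a | t < min 1 (|Y a| / r)} ⊆ {a | r * t < |Y a|} := by
      intro a ha
      rw [mem_ofPred_eq] at ha
      have := (lt_min_iff.1 ha).2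
      rw [lt_div_iff₀ hr] at this
      simpa [mul_comm] using this
    calc _ ≤ ENNReal.ofReal (8 * s * (r * t) ^ (-α)) * ENNReal.ofReal (t ^ (2 - 1 : ℝ)) := by
          gcongr
          exact (measure_mono hsub).trans (hY.tail_le hs hα (mul_pos hr ht.1))
      _ = _ := by
        have ht0 := ht.1
        rw [← ENNReal.ofReal_mul (by positivity), ← ENNReal.ofReal_mul (by positivity),
          Real.mul_rpow hr.le ht0.le]
        congr 1
        rw [show (1 - α) = -α + (2 - 1) by ring, Real.rpow_add ht0]
        ring
  rw [lintegral_const_mul' _ _ ENNReal.ofReal_ne_top,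
    lintegral_Ioc_rpow (by linarith [hα.2]) zero_le_one] at key
  calc _ ≤ ENNReal.ofReal 2 * (ENNReal.ofReal (8 * s * r ^ (-α)) *
        ENNReal.ofReal (1 ^ (1 - α + 1) / (1 - α + 1))) := by gcongr
    _ = _ := by
      have h2α' : 1 - α + 1 ≠ 0 := by linarith
      rw [← ENNReal.ofReal_mul (by positivity), ← ENNReal.ofReal_mul (by positivity),
        Real.one_rpow]
      congr 1
      rw [show 1 - α + 1 = 2 - α by ring]
      field_simp
      ring

variable {H : Type*} [NormedAddCommGroup H] [InnerProductSpace ℝ H]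

/-- A random vector with symmetric stable orthogonal coordinates is weakly `L^α`. Truncating the
coordinates at the level of the tail makes independence of the coordinates unnecessary. -/
lemma tail_sum_smul_le [IsProbabilityMeasure P] {ι : Type*} {v : ι → H} (hv : Orthonormal ℝ v)
    {α : ℝ} (hα : α ∈ Ioo 1 2) (F : Finset ι) {s : ι → ℝ} {Y : ι → Ω → ℝ}
    (hs : ∀ k ∈ F, 0 ≤ s k) (hY : ∀ k ∈ F, IsStableVar α (s k) (Y k) P) {r : ℝ} (hr : 0 < r) :
    P {ω | r < ‖∑ k ∈ F, Y k ω • v k‖} ≤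
      ENNReal.ofReal (16 / (2 - α) * (∑ k ∈ F, s k) * r ^ (-α)) := by
  have h2α : 0 < 2 - α := by linarith [hα.2]
  set g : Ω → ℝ≥0∞ := fun ω => ∑ k ∈ F, ENNReal.ofReal ((min 1 (|Y k ω| / r)) ^ (2 : ℝ)) with hg
  have hmeas : ∀ k ∈ F, Measurable fun ω => ENNReal.ofReal ((min 1 (|Y k ω| / r)) ^ (2 : ℝ)) := by
    intro k hk
    have := (hY k hk).measurable
    fun_prop
  have hsub : {ω | r < ‖∑ k ∈ F, Y k ω • v k‖} ⊆ {ω | 1 ≤ g ω} := by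
    intro ω hω
    simp only [mem_ofPred_eq] at hω ⊢
    by_cases hex : ∃ k ∈ F, r ≤ |Y k ω|
    · obtain ⟨k, hk, hkr⟩ := hex
      have h1 : ENNReal.ofReal ((min 1 (|Y k ω| / r)) ^ (2 : ℝ)) = 1 := by
        rw [min_eq_left ((one_le_div hr).2 hkr)]; simp
      rw [← h1]
      exact Finset.single_le_sum (f := fun k => ENNReal.ofReal ((min 1 (|Y k ω| / r)) ^ (2 : ℝ)))
        (fun _ _ => zero_le) hk
    · push Not at hex
      have h2 : ∀ k ∈ F, (min 1 (|Y k ω| / r)) ^ (2 : ℝ) = Y k ω ^ 2 / r ^ 2 := by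
        intro k hk
        rw [min_eq_right ((div_le_one hr).2 (hex k hk).le), Real.rpow_two, div_pow, sq_abs]
      rw [hg]
      simp only
      rw [← ENNReal.ofReal_sum_of_nonneg (fun k hk => by positivity), Finset.sum_congr rfl h2,
        ← Finset.sum_div, ENNReal.one_le_ofReal, one_le_div (by positivity)]
      have h3 : ‖∑ k ∈ F, Y k ω • v k‖ ^ 2 = ∑ k ∈ F, Y k ω ^ 2 := by
        rw [← real_inner_self_eq_norm_sq, hv.inner_sum]
        simp [sq]
      rw [← h3]
      gcongr
  calc _ ≤ P {ω | 1 ≤ g ω} := measure_mono hsub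
    _ ≤ ∫⁻ ω, g ω ∂P := by
      have := mul_meas_ge_le_lintegral (μ := P) (Finset.measurable_sum F hmeas) 1
      simpa [hg] using this
    _ = ∑ k ∈ F, ∫⁻ ω, ENNReal.ofReal ((min 1 (|Y k ω| / r)) ^ (2 : ℝ)) ∂P :=
      lintegral_finsetSum' _ fun k hk => (hmeas k hk).aemeasurable
    _ ≤ ∑ k ∈ F, ENNReal.ofReal (16 / (2 - α) * s k * r ^ (-α)) :=
      Finset.sum_le_sum fun k hk => (hY k hk).lintegral_min_le (hs k hk) hα hr
    _ = _ := by
      rw [← ENNReal.ofReal_sum_of_nonneg fun k hk => by have := hs k hk; positivity]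
      simp only [Finset.mul_sum, Finset.sum_mul]

/-- The constant in the `L^m` estimate of stable random vectors. -/
noncomputable def stableConst (α m : ℝ) : ℝ :=
  (α / (α - m)) ^ (1 / m) * (16 / (2 - α)) ^ (1 / α)

lemma stableConst_pos {α m : ℝ} (hα : α ∈ Ioo 1 2) (hm : m ∈ Ico 1 α) : 0 < stableConst α m := by
  have h1 : 0 < α - m := by linarith [hm.2]
  have h2 : 0 < 2 - α := by linarith [hα.2]
  have h3 : 0 < α := by linarith [hα.1]
  unfold stableConst
  positivity

/-- **Moment estimate for stable vectors**: the `L^m` norm is at most a constant times the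
`1/α`-th power of the sum of the scales of the coordinates. -/
lemma eLpNorm_sum_smul_le [IsProbabilityMeasure P] {ι : Type*} {v : ι → H} (hv : Orthonormal ℝ v)
    {α m : ℝ} (hα : α ∈ Ioo 1 2) (hm : m ∈ Ico 1 α) (F : Finset ι) {s : ι → ℝ} {Y : ι → Ω → ℝ}
    (hs : ∀ k ∈ F, 0 ≤ s k) (hY : ∀ k ∈ F, IsStableVar α (s k) (Y k) P) {σ : ℝ}
    (hσ : ∑ k ∈ F, s k ≤ σ) :
    eLpNorm (fun ω => ∑ k ∈ F, Y k ω • v k) (ENNReal.ofReal m) P ≤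
      ENNReal.ofReal (stableConst α m * σ ^ (1 / α)) := by
  have h2α : 0 < 2 - α := by linarith [hα.2]
  have hm0 : 0 < m := by linarith [hm.1]
  have hα0 : 0 < α := by linarith [hα.1]
  have hαm : 0 < α - m := by linarith [hm.2]
  have hσ0 : 0 ≤ σ := (Finset.sum_nonneg hs).trans hσ
  have hYm : AEMeasurable (fun ω => ‖∑ k ∈ F, Y k ω • v k‖) P := by
    refine AEStronglyMeasurable.aemeasurable (AEStronglyMeasurable.norm ?_)
    refine Finset.aestronglyMeasurable_fun_sum _ fun k hk => ?_
    exact ((hY k hk).measurable.stronglyMeasurable.smul_const _).aestronglyMeasurable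
  have main : ∀ σ', σ < σ' → eLpNorm (fun ω => ∑ k ∈ F, Y k ω • v k) (ENNReal.ofReal m) P ≤
      ENNReal.ofReal (stableConst α m * σ' ^ (1 / α)) := by
    intro σ' hσ'
    have hσ'0 : 0 < σ' := hσ0.trans_lt hσ'
    have hC : 0 < 16 / (2 - α) := by positivity
    have h1 := lintegral_rpow_le_of_tail (P := P) (fun ω => norm_nonneg (∑ k ∈ F, Y k ω • v k)) hYm
      hm0 hm.2 (mul_pos hC hσ'0) (fun r hr => (tail_sum_smul_le hv hα F hs hY hr).trans (by
        gcongr; exact hσ.trans hσ'.le))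
    rw [eLpNorm_eq_lintegral_rpow_enorm_toReal (by simpa using hm0) ENNReal.ofReal_ne_top,
      ENNReal.toReal_ofReal hm0.le]
    have h2 : ∀ ω, ‖∑ k ∈ F, Y k ω • v k‖ₑ ^ m
        = ENNReal.ofReal (‖∑ k ∈ F, Y k ω • v k‖ ^ m) := fun ω => by
      rw [← ofReal_norm, ENNReal.ofReal_rpow_of_nonneg (norm_nonneg _) hm0.le]
    simp_rw [h2]
    calc _ ≤ ENNReal.ofReal (α / (α - m) * (16 / (2 - α) * σ') ^ (m / α)) ^ (1 / m) := by gcongr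
      _ = _ := by
        rw [ENNReal.ofReal_rpow_of_nonneg (by positivity) (by positivity),
          Real.mul_rpow (by positivity) (by positivity), ← Real.rpow_mul (by positivity),
          show m / α * (1 / m) = 1 / α by field_simp, Real.mul_rpow hC.le hσ'0.le, stableConst]
        congr 1; ring
  have hcont : Tendsto (fun σ' : ℝ => ENNReal.ofReal (stableConst α m * σ' ^ (1 / α))) (𝓝[>] σ)
      (𝓝 (ENNReal.ofReal (stableConst α m * σ ^ (1 / α)))) := by
    refine (ENNReal.continuous_ofReal.tendsto _).comp ?_
    refine Tendsto.mono_left ?_ nhdsWithin_le_nhds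
    exact ((Real.continuous_rpow_const (by positivity)).tendsto σ).const_mul _
  exact ge_of_tendsto hcont (eventually_nhdsWithin_of_forall main)

/-- The scalar case of `eLpNorm_sum_smul_le`. -/
lemma IsStableVar.eLpNorm_le [IsProbabilityMeasure P] {α m s : ℝ} (hα : α ∈ Ioo 1 2)
    (hm : m ∈ Ico 1 α) {Y : Ω → ℝ} (hY : IsStableVar α s Y P) (hs : 0 ≤ s) {σ : ℝ} (hσ : s ≤ σ) :
    eLpNorm Y (ENNReal.ofReal m) P ≤ ENNReal.ofReal (stableConst α m * σ ^ (1 / α)) := by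
  have hv : Orthonormal ℝ (fun _ : Unit => (1 : ℝ)) := by
    refine ⟨fun _ => by simp, fun i j hij => (hij (Subsingleton.elim i j)).elim⟩
  have := eLpNorm_sum_smul_le (P := P) hv hα hm Finset.univ (s := fun _ => s) (Y := fun _ => Y)
    (fun _ _ => hs) (fun _ _ => hY) (σ := σ) (by simpa using hσ)
  simpa using this

end StableMoments

/-! ### Riemann sums against a stable process -/

section RiemannSums

/-- The `n`-th Riemann sum of `∫₀ᵗ e^{-lam(t-s)} dℓ_s`. -/
noncomputable def riemannSum {Ω : Type*} (ℓ : ℝ≥0 → Ω → ℝ) (lam : ℝ) (n : ℕ) (t : ℝ≥0) (ω : Ω) :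
    ℝ :=
  ∑ i ∈ Finset.range n, Real.exp (-lam * ((t : ℝ) - (t * i / n : ℝ≥0))) *
    (ℓ (t * (i + 1) / n) ω - ℓ (t * i / n) ω)

lemma monotone_grid (t : ℝ≥0) (n : ℕ) : Monotone fun j : ℕ => t * j / n := fun i j h => by
  dsimp only; gcongr

lemma grid_le (t : ℝ≥0) {n i : ℕ} (hi : i ≤ n) : t * i / n ≤ t := by
  rcases Nat.eq_zero_or_pos n with rfl | hn
  · simp
  · calc t * i / n ≤ t * n / n := by gcongr
      _ = t := by field_simp

lemma measurable_riemannSum {Ω : Type*} {m₀ : MeasurableSpace Ω} {ℓ : ℝ≥0 → Ω → ℝ} {t : ℝ≥0}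
    (h : ∀ s ≤ t, Measurable[m₀] (ℓ s)) (lam : ℝ) (n : ℕ) :
    Measurable[m₀] (riemannSum ℓ lam n t) := by
  refine Finset.measurable_sum _ fun i hi => Measurable.const_mul
      (Measurable.sub (h _ ?_) (h _ ?_)) _
  · exact_mod_cast grid_le t (Finset.mem_range.1 hi)
  · exact grid_le t (Finset.mem_range.1 hi).le

/-- Splitting every increment of a Riemann sum into `m` increments. -/
lemma sum_mul_sub_refine (c g : ℕ → ℝ) (n m : ℕ) (hm : 0 < m) :
    ∑ i ∈ Finset.range n, c i * (g ((i + 1) * m) - g (i * m)) =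
      ∑ j ∈ Finset.range (n * m), c (j / m) * (g (j + 1) - g j) := by
  induction n with
  | zero => simp
  | succ n ih =>
    rw [Finset.sum_range_succ, ih, add_mul, one_mul, Finset.sum_range_add]
    congr 1
    have : ∀ x ∈ Finset.range m, c ((n * m + x) / m) * (g (n * m + x + 1) - g (n * m + x))
        = c n * (g (n * m + (x + 1)) - g (n * m + x)) := by
      intro x hx
      rw [mul_comm n m, Nat.mul_add_div hm, Nat.div_eq_of_lt (Finset.mem_range.1 hx), add_zero,
          add_assoc]
    rw [Finset.sum_congr rfl this, ← Finset.mul_sum,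
      Finset.sum_range_sub (fun x => g (n * m + x)), add_zero]

/-- A Riemann sum written on the common refinement of two uniform grids. -/
lemma riemannSum_refine {Ω : Type*} (ℓ : ℝ≥0 → Ω → ℝ) (lam : ℝ) (t : ℝ≥0) {n m : ℕ} (hn : 0 < n)
    (hm : 0 < m)
    (ω : Ω) : riemannSum ℓ lam n t ω = ∑ j ∈ Finset.range (n * m),
      Real.exp (-lam * ((t : ℝ) - (t * (j / m : ℕ) / n : ℝ≥0))) *
        (ℓ (t * (j + 1 : ℕ) / (n * m : ℕ)) ω - ℓ (t * j / (n * m : ℕ)) ω) := by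
  have h := sum_mul_sub_refine (fun i => Real.exp (-lam * ((t : ℝ) - (t * (i : ℕ) / n : ℝ≥0))))
    (fun j => ℓ (t * j / (n * m : ℕ)) ω) n m hm
  rw [← h]
  refine Finset.sum_congr rfl fun i _ => ?_
  have h1 : ∀ k : ℕ, t * (k * m : ℕ) / (n * m : ℕ) = t * k / n := fun k => by
    push_cast
    field_simp
  rw [h1, h1]
  push_cast
  rfl

lemma abs_exp_neg_sub_le {lam t x y : ℝ} (hlam : 0 < lam) (hx : x ≤ t) (hy : y ≤ t) :
    |Real.exp (-lam * (t - x)) - Real.exp (-lam * (t - y))| ≤ lam * |x - y| := by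
  wlog h : y ≤ x generalizing x y
  · rw [abs_sub_comm, abs_sub_comm x]; exact this hy hx (le_of_not_ge h)
  have h1 : Real.exp (-lam * (t - y)) = Real.exp (-lam * (t - x)) * Real.exp (-lam * (x - y)) := by
    rw [← Real.exp_add]; congr 1; ring
  have h2 := Real.add_one_le_exp (-lam * (x - y))
  have h3 : Real.exp (-lam * (x - y)) ≤ 1 := Real.exp_le_one_iff.2 (by nlinarith)
  have h4 : Real.exp (-lam * (t - x)) ≤ 1 := Real.exp_le_one_iff.2 (by nlinarith)
  have h5 := Real.exp_pos (-lam * (t - x))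
  rw [h1, abs_of_nonneg (by nlinarith), abs_of_nonneg (by linarith)]
  nlinarith

variable {Ω : Type*} [mΩ : MeasurableSpace Ω] {P : Measure Ω} {α : ℝ} {ℓ : ℝ≥0 → Ω → ℝ}

lemma IsSymmetricStable.isStableVar (hℓ : IsSymmetricStable α ℓ P) (t : ℝ≥0) :
    IsStableVar α t (ℓ t) P :=
  ⟨hℓ.measurable t, fun h => by rw [hℓ.charFun_eq]; congr 3; ring⟩

lemma IsSymmetricStable.isStableVar_sub (hℓ : IsSymmetricStable α ℓ P) {s t : ℝ≥0} (hst : s ≤ t) :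
    IsStableVar α (t - s) (fun ω => ℓ t ω - ℓ s ω) P := by
  refine ⟨(hℓ.measurable t).sub (hℓ.measurable s), fun h => ?_⟩
  have h1 := (hℓ.stationary_increments s t hst).map_eq
  have h2 := (hℓ.isStableVar (t - s)).charFun_eq h
  rw [← h1, NNReal.coe_sub hst] at h2
  exact h2

/-- Linear combinations of increments along a partition are stable, by independence. -/
lemma IsSymmetricStable.isStableVar_sum [IsProbabilityMeasure P] (hℓ : IsSymmetricStable α ℓ P)
    {τ : ℕ → ℝ≥0} (hτ : Monotone τ) (a : ℕ → ℝ) (N : ℕ) :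
    IsStableVar α (∑ j ∈ Finset.range N, |a j| ^ α * ((τ (j + 1) : ℝ) - τ j))
      (fun ω => ∑ j ∈ Finset.range N, a j * (ℓ (τ (j + 1)) ω - ℓ (τ j) ω)) P := by
  have h1 : ∀ j, IsStableVar α (|a j| ^ α * ((τ (j + 1) : ℝ) - τ j))
      (fun ω => a j * (ℓ (τ (j + 1)) ω - ℓ (τ j) ω)) P :=
    fun j => (hℓ.isStableVar_sub (hτ j.le_succ)).const_mul (a j)
  refine ⟨Finset.measurable_sum _ fun j _ => (h1 j).measurable, fun h => ?_⟩
  have hind : iIndepFun (fun j ω => a j * (ℓ (τ (j + 1)) ω - ℓ (τ j) ω)) P :=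
    (hℓ.indep_increments.nat hτ).comp (fun j x => a j * x) (fun j => measurable_const_mul _)
  rw [(hind.restrict _).charFun_map_fun_finsetSum_eq_prod
    (s := Finset.range N) fun j _ => (h1 j).measurable.aemeasurable, Finset.prod_apply,
    Finset.prod_congr rfl fun j _ => (h1 j).charFun_eq h, ← Complex.ofReal_prod, ← Real.exp_sum,
    Finset.sum_neg_distrib, Finset.sum_mul]

/-- The Riemann sums are stable, with a scale bounded uniformly in the time and the mesh. -/
lemma IsSymmetricStable.isStableVar_riemannSum [IsProbabilityMeasure P]
    (hℓ : IsSymmetricStable α ℓ P) (hα : α ∈ Ioo 1 2) {lam : ℝ} (hlam : 0 < lam) (n : ℕ) (t : ℝ≥0) :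
    ∃ s, 0 ≤ s ∧ s ≤ 1 / (α * lam) ∧ IsStableVar α s (riemannSum ℓ lam n t) P := by
  have hα0 : 0 < α := by linarith [hα.1]
  have hmono := monotone_grid t n
  have hgrid := hℓ.isStableVar_sum hmono
    (fun i : ℕ => Real.exp (-lam * ((t : ℝ) - (t * i / n : ℝ≥0)))) n
  have hfun : riemannSum ℓ lam n t = fun ω => ∑ i ∈ Finset.range n,
      Real.exp (-lam * ((t : ℝ) - (t * i / n : ℝ≥0))) *
        (ℓ (t * (i + 1 : ℕ) / n) ω - ℓ (t * i / n) ω) := by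
    funext ω
    simp only [riemannSum, Nat.cast_add, Nat.cast_one]
  rw [hfun]
  refine ⟨_, Finset.sum_nonneg fun i _ => ?_, ?_, hgrid⟩
  · have : ((t * (i : ℕ) / n : ℝ≥0) : ℝ) ≤ (t * (i + 1 : ℕ) / n : ℝ≥0) :=
      NNReal.coe_le_coe.2 (hmono i.le_succ)
    exact mul_nonneg (by positivity) (sub_nonneg.2 this)
  -- each term is at most the integral of the increasing function `s ↦ e^{-α lam (t-s)}`
  have hterm : ∀ i ∈ Finset.range n,
      |Real.exp (-lam * ((t : ℝ) - (t * i / n : ℝ≥0)))| ^ α *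
        (((t * (i + 1 : ℕ) / n : ℝ≥0) : ℝ) - (t * i / n : ℝ≥0)) ≤
      1 / (α * lam) * (Real.exp (-(α * lam) * ((t : ℝ) - (t * (i + 1 : ℕ) / n : ℝ≥0))) -
        Real.exp (-(α * lam) * ((t : ℝ) - (t * i / n : ℝ≥0)))) := by
    intro i _
    set x : ℝ := ((t * i / n : ℝ≥0) : ℝ)
    set y : ℝ := ((t * (i + 1 : ℕ) / n : ℝ≥0) : ℝ)
    rw [abs_of_pos (Real.exp_pos _), ← Real.exp_mul]
    have h1 : Real.exp (-(α * lam) * (t - y))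
        = Real.exp (-lam * (t - x) * α) * Real.exp (α * lam * (y - x)) := by
      rw [← Real.exp_add]; congr 1; ring
    have h2 : Real.exp (-(α * lam) * (t - x)) = Real.exp (-lam * (t - x) * α) := by
      congr 1; ring
    rw [h1, h2]
    have h3 := Real.add_one_le_exp (α * lam * (y - x))
    have h4 : y - x ≤ 1 / (α * lam) * (Real.exp (α * lam * (y - x)) - 1) := by
      rw [one_div, inv_mul_eq_div, le_div_iff₀ (by positivity)]
      linarith
    calc _ ≤ Real.exp (-lam * (t - x) * α) * (1 / (α * lam) *
        (Real.exp (α * lam * (y - x)) - 1)) := by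
          gcongr
      _ = _ := by ring
  refine (Finset.sum_le_sum hterm).trans ?_
  rw [← Finset.mul_sum, Finset.sum_range_sub
    (fun i : ℕ => Real.exp (-(α * lam) * ((t : ℝ) - (t * i / n : ℝ≥0))))]
  have h5 : Real.exp (-(α * lam) * ((t : ℝ) - (t * n / n : ℝ≥0))) ≤ 1 := by
    rw [Real.exp_le_one_iff]
    have : ((t * n / n : ℝ≥0) : ℝ) ≤ t := NNReal.coe_le_coe.2 (grid_le t le_rfl)
    have : 0 < α * lam := by positivity
    nlinarith
  have h6 := Real.exp_pos (-(α * lam) * ((t : ℝ) - (t * (0 : ℕ) / n : ℝ≥0)))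
  have h7 : 0 ≤ 1 / (α * lam) := by positivity
  calc _ ≤ 1 / (α * lam) * 1 := by gcongr; linarith
    _ = _ := mul_one _

/-- The Riemann sums are Cauchy in `L^m`, locally uniformly in time. -/
lemma IsSymmetricStable.eLpNorm_riemannSum_sub_le [IsProbabilityMeasure P]
    (hℓ : IsSymmetricStable α ℓ P) (hα : α ∈ Ioo 1 2) {m : ℝ} (hm : m ∈ Ico 1 α) {lam : ℝ}
    (hlam : 0 < lam) {N n : ℕ} (hN : 0 < N) (hn : N ≤ n) {t T : ℝ≥0} (ht : t ≤ T) :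
    eLpNorm (fun ω => riemannSum ℓ lam N t ω - riemannSum ℓ lam n t ω) (ENNReal.ofReal m) P ≤
      ENNReal.ofReal (stableConst α m * ((lam * T / N) ^ α * T) ^ (1 / α)) := by
  have hn0 : 0 < n := hN.trans_le hn
  have hα0 : 0 < α := by linarith [hα.1]
  set a : ℕ → ℝ := fun j => Real.exp (-lam * ((t : ℝ) - (t * (j / n : ℕ) / N : ℝ≥0))) -
    Real.exp (-lam * ((t : ℝ) - (t * (j / N : ℕ) / n : ℝ≥0))) with ha
  have hmono := monotone_grid t (N * n)
  have heq : (fun ω => riemannSum ℓ lam N t ω - riemannSum ℓ lam n t ω) = fun ω =>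
      ∑ j ∈ Finset.range (N * n), a j *
        (ℓ (t * (j + 1 : ℕ) / (N * n : ℕ)) ω - ℓ (t * j / (N * n : ℕ)) ω) := by
    funext ω
    rw [riemannSum_refine ℓ lam t hN hn0, riemannSum_refine ℓ lam t hn0 hN, mul_comm n N,
      ← Finset.sum_sub_distrib]
    refine Finset.sum_congr rfl fun j _ => ?_
    rw [ha]; ring
  have hst := hℓ.isStableVar_sum hmono a (N * n)
  rw [heq]
  refine hst.eLpNorm_le hα hm (Finset.sum_nonneg fun j _ => ?_) ?_
  · exact mul_nonneg (by positivity) (sub_nonneg.2 (NNReal.coe_le_coe.2 (hmono j.le_succ)))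
  have hterm : ∀ j ∈ Finset.range (N * n),
      |a j| ^ α * (((t * (j + 1 : ℕ) / (N * n : ℕ) : ℝ≥0) : ℝ) - (t * j / (N * n : ℕ) : ℝ≥0)) ≤
      (lam * T / N) ^ α *
        (((t * (j + 1 : ℕ) / (N * n : ℕ) : ℝ≥0) : ℝ) - (t * j / (N * n : ℕ) : ℝ≥0)) := by
    intro j hj
    have := sub_nonneg.2 (NNReal.coe_le_coe.2 (hmono j.le_succ))
    gcongr
    rw [Finset.mem_range] at hj
    have hj1 : j / n ≤ N := (Nat.div_lt_of_lt_mul (by rwa [mul_comm] at hj)).le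
    have hj2 : j / N ≤ n := (Nat.div_lt_of_lt_mul hj).le
    refine (abs_exp_neg_sub_le hlam (NNReal.coe_le_coe.2 (grid_le t hj1))
      (NNReal.coe_le_coe.2 (grid_le t hj2))).trans ?_
    rw [mul_div_assoc lam]
    gcongr
    push_cast
    have hNR : (0 : ℝ) < N := by exact_mod_cast hN
    have hnR : (0 : ℝ) < n := by exact_mod_cast hn0
    -- both grid points lie within one mesh size of `t j / (N n)`
    have e1 : ((j / n : ℕ) : ℝ) / N ≤ j / (N * n) := by
      rw [mul_comm, ← div_div]
      gcongr
      exact Nat.cast_div_le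
    have e2 : ((j / N : ℕ) : ℝ) / n ≤ j / (N * n) := by
      rw [← div_div]
      gcongr
      exact Nat.cast_div_le
    have e3 : (j : ℝ) / (N * n) ≤ ((j / n : ℕ) : ℝ) / N + 1 / N := by
      rw [← add_div, mul_comm, ← div_div]
      gcongr
      rw [div_le_iff₀ hnR]
      have := Nat.lt_div_mul_add (a := j) hn0
      have : j ≤ (j / n + 1) * n := by rw [add_mul, one_mul]; exact this.le
      exact_mod_cast this
    have e4 : (j : ℝ) / (N * n) ≤ ((j / N : ℕ) : ℝ) / n + 1 / N := by
      have : (j : ℝ) / (N * n) ≤ ((j / N : ℕ) : ℝ) / n + 1 / n := by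
        rw [← add_div, ← div_div]
        gcongr
        rw [div_le_iff₀ hNR]
        have := Nat.lt_div_mul_add (a := j) hN
        have : j ≤ (j / N + 1) * N := by rw [add_mul, one_mul]; exact this.le
        exact_mod_cast this
      refine this.trans ?_
      gcongr
    have e5 : |((j / n : ℕ) : ℝ) / N - ((j / N : ℕ) : ℝ) / n| ≤ 1 / N :=
      abs_le.2 ⟨by linarith, by linarith⟩
    calc |(t : ℝ) * ((j / n : ℕ) : ℝ) / N - t * ((j / N : ℕ) : ℝ) / n|
        = t * |((j / n : ℕ) : ℝ) / N - ((j / N : ℕ) : ℝ) / n| := by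
          rw [mul_div_assoc, mul_div_assoc, ← mul_sub, abs_mul, abs_of_nonneg t.coe_nonneg]
      _ ≤ T * (1 / N) := by gcongr
      _ = _ := by ring
  refine (Finset.sum_le_sum hterm).trans ?_
  rw [← Finset.mul_sum, Finset.sum_range_sub
    (fun j : ℕ => ((t * j / (N * n : ℕ) : ℝ≥0) : ℝ))]
  gcongr
  have : ((t * (N * n : ℕ) / (N * n : ℕ) : ℝ≥0) : ℝ) ≤ t := NNReal.coe_le_coe.2 (grid_le t le_rfl)
  have h2 : (t : ℝ) ≤ T := NNReal.coe_le_coe.2 ht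
  simp only [Nat.cast_zero, mul_zero, zero_div, NNReal.coe_zero, sub_zero]
  linarith

end RiemannSums

/-! ### The stochastic integrals as continuous curves in `L^m` -/

/-- Locally uniformly Cauchy sequences of continuous curves have a continuous limit, with the same
rate. -/
lemma exists_continuous_limit {E : Type*} [MetricSpace E] [CompleteSpace E] {f : ℕ → ℝ≥0 → E}
    (hf : ∀ n, Continuous (f n)) {b : ℝ≥0 → ℕ → ℝ} (hb : ∀ T, Tendsto (b T) atTop (𝓝 0))
    (h : ∀ T t, t ≤ T → ∀ N n, N ≤ n → dist (f N t) (f n t) ≤ b T N) :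
    ∃ g : ℝ≥0 → E, Continuous g ∧ ∀ T t, t ≤ T → ∀ N, dist (f N t) (g t) ≤ b T N := by
  have hlim : ∀ t, ∃ y, Tendsto (fun n => f n t) atTop (𝓝 y) := fun t =>
    cauchySeq_tendsto_of_complete (cauchySeq_of_le_tendsto_0' (b t) (h t t le_rfl) (hb t))
  choose g hg using hlim
  have hdist : ∀ T t, t ≤ T → ∀ N, dist (f N t) (g t) ≤ b T N := fun T t ht N =>
    le_of_tendsto (tendsto_const_nhds.dist (hg t))
      (eventually_atTop.2 ⟨N, fun n hn => h T t ht N n hn⟩)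
  refine ⟨g, continuous_iff_continuousAt.2 fun t => ?_, hdist⟩
  have hunif : TendstoUniformlyOn f g atTop (Iio (t + 1)) := by
    rw [Metric.tendstoUniformlyOn_iff]
    intro ε hε
    filter_upwards [(hb (t + 1)).eventually (gt_mem_nhds hε)] with n hn s hs
    rw [dist_comm]
    exact (hdist (t + 1) s (le_of_lt hs) n).trans_lt hn
  exact (hunif.continuousOn (Frequently.of_forall fun n => (hf n).continuousOn)).continuousAt
    (Iio_mem_nhds (by simp))

section StochIntegral

variable {Ω : Type*} [mΩ : MeasurableSpace Ω] {P : Measure Ω} [IsProbabilityMeasure P]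
  {α m : ℝ} {ℓ : ℝ≥0 → Ω → ℝ}

lemma IsStableVar.memLp (hα : α ∈ Ioo 1 2) (hm : m ∈ Ico 1 α) {s : ℝ} (hs : 0 ≤ s) {Y : Ω → ℝ}
    (hY : IsStableVar α s Y P) : MemLp Y (ENNReal.ofReal m) P :=
  ⟨hY.measurable.aestronglyMeasurable,
    (hY.eLpNorm_le hα hm hs le_rfl).trans_lt ENNReal.ofReal_lt_top⟩

lemma IsSymmetricStable.memLp (hℓ : IsSymmetricStable α ℓ P) (hα : α ∈ Ioo 1 2) (hm : m ∈ Ico 1 α)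
    (t : ℝ≥0) : MemLp (ℓ t) (ENNReal.ofReal m) P :=
  (hℓ.isStableVar t).memLp hα hm t.2

lemma IsSymmetricStable.memLp_riemannSum (hℓ : IsSymmetricStable α ℓ P) (hα : α ∈ Ioo 1 2)
    (hm : m ∈ Ico 1 α) {lam : ℝ} (hlam : 0 < lam) (n : ℕ) (t : ℝ≥0) :
    MemLp (riemannSum ℓ lam n t) (ENNReal.ofReal m) P := by
  obtain ⟨s, hs, -, h⟩ := hℓ.isStableVar_riemannSum hα hlam n t
  exact h.memLp hα hm hs

lemma IsSymmetricStable.continuous_toLp [Fact (1 ≤ ENNReal.ofReal m)]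
    (hℓ : IsSymmetricStable α ℓ P) (hα : α ∈ Ioo 1 2)
    (hm : m ∈ Ico 1 α) : Continuous fun t => (hℓ.memLp hα hm t).toLp := by
  have hα0 : 0 < α := by linarith [hα.1]
  have hle : ∀ s t, s ≤ t → dist ((hℓ.memLp hα hm t).toLp) ((hℓ.memLp hα hm s).toLp) ≤
      stableConst α m * |(t : ℝ) - s| ^ (1 / α) := by
    intro s t hst
    have hst' : (0 : ℝ) ≤ t - s := sub_nonneg.2 (NNReal.coe_le_coe.2 hst)
    have h := (hℓ.isStableVar_sub hst).eLpNorm_le hα hm hst' (le_abs_self _)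
    have hK := stableConst_pos hα hm
    rw [dist_eq_norm, ← MemLp.toLp_sub, Lp.norm_toLp]
    exact ENNReal.toReal_le_of_le_ofReal (by positivity) h
  have hle' : ∀ s t, dist ((hℓ.memLp hα hm t).toLp) ((hℓ.memLp hα hm s).toLp) ≤
      stableConst α m * |(t : ℝ) - s| ^ (1 / α) := by
    intro s t
    rcases le_total s t with hst | hst
    · exact hle s t hst
    · rw [dist_comm, abs_sub_comm]; exact hle t s hst
  refine continuous_iff_continuousAt.2 fun s => tendsto_iff_dist_tendsto_zero.2 ?_
  have hcont : Continuous fun t : ℝ≥0 => stableConst α m * |(t : ℝ) - s| ^ (1 / α) :=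
    continuous_const.mul ((Real.continuous_rpow_const (by positivity)).comp (by fun_prop))
  refine squeeze_zero (fun _ => dist_nonneg) (hle' s) ?_
  have := hcont.tendsto s
  simpa [Real.zero_rpow (one_div_pos.2 hα0).ne', hα0.ne'] using this

lemma IsSymmetricStable.continuous_toLp_riemannSum [Fact (1 ≤ ENNReal.ofReal m)]
    (hℓ : IsSymmetricStable α ℓ P) (hα : α ∈ Ioo 1 2) (hm : m ∈ Ico 1 α) {lam : ℝ}
    (hlam : 0 < lam) (n : ℕ) : Continuous fun t => (hℓ.memLp_riemannSum hα hm hlam n t).toLp := by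
  have heq : (fun t => (hℓ.memLp_riemannSum hα hm hlam n t).toLp) = fun t : ℝ≥0 =>
      ∑ i ∈ Finset.range n, Real.exp (-lam * ((t : ℝ) - (t * i / n : ℝ≥0))) •
        ((hℓ.memLp hα hm (t * (i + 1) / n)).toLp - (hℓ.memLp hα hm (t * i / n)).toLp) := by
    funext t
    apply Lp.ext
    refine (MemLp.coeFn_toLp _).trans ?_
    refine EventuallyEq.trans ?_ (Lp.coeFn_finsetSum _ _).symm
    have h : ∀ᵐ ω ∂P, ∀ i : ℕ, (Real.exp (-lam * ((t : ℝ) - (t * i / n : ℝ≥0))) •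
        ((hℓ.memLp hα hm (t * (i + 1) / n)).toLp - (hℓ.memLp hα hm (t * i / n)).toLp) :
          Lp ℝ (ENNReal.ofReal m) P) ω = Real.exp (-lam * ((t : ℝ) - (t * i / n : ℝ≥0))) *
        (ℓ (t * (i + 1) / n) ω - ℓ (t * i / n) ω) := by
      refine ae_all_iff.2 fun i => ?_
      filter_upwards [Lp.coeFn_smul (Real.exp (-lam * ((t : ℝ) - (t * i / n : ℝ≥0))))
        ((hℓ.memLp hα hm (t * (i + 1) / n)).toLp - (hℓ.memLp hα hm (t * i / n)).toLp),
        Lp.coeFn_sub (hℓ.memLp hα hm (t * (i + 1) / n)).toLp (hℓ.memLp hα hm (t * i / n)).toLp,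
        (hℓ.memLp hα hm (t * (i + 1) / n)).coeFn_toLp, (hℓ.memLp hα hm (t * i / n)).coeFn_toLp]
        with ω h1 h2 h3 h4
      rw [h1, Pi.smul_apply, h2, Pi.sub_apply, h3, h4, smul_eq_mul]
    filter_upwards [h] with ω hω
    rw [Finset.sum_apply, Finset.sum_congr rfl fun i _ => hω i]
    rfl
  rw [heq]
  refine continuous_finsetSum _ fun i _ => Continuous.fun_smul ?_ (Continuous.fun_sub ?_ ?_)
  · have : Continuous fun t : ℝ≥0 => ((t * i / n : ℝ≥0) : ℝ) :=
      NNReal.continuous_coe.comp ((continuous_id.mul continuous_const).div_const _)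
    fun_prop
  · exact (hℓ.continuous_toLp hα hm).comp ((continuous_id.mul continuous_const).div_const _)
  · exact (hℓ.continuous_toLp hα hm).comp ((continuous_id.mul continuous_const).div_const _)

/-- The integrals `∫₀ᵗ e^{-lam(t-s)} dℓ_s` form a continuous curve in `L^m`. -/
lemma exists_stochIntegral [Fact (1 ≤ ENNReal.ofReal m)]
    (hℓ : IsSymmetricStable α ℓ P) (hα : α ∈ Ioo 1 2) (hm : m ∈ Ico 1 α) {lam : ℝ}
    (hlam : 0 < lam) : ∃ I : ℝ≥0 → Lp ℝ (ENNReal.ofReal m) P, Continuous I ∧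
      ∀ t, Tendsto (fun n => (hℓ.memLp_riemannSum hα hm hlam n t).toLp) atTop (𝓝 (I t)) := by
  have hα0 : 0 < α := by linarith [hα.1]
  set b : ℝ≥0 → ℕ → ℝ := fun T N =>
    stableConst α m * ((lam * T / (N + 1 : ℕ)) ^ α * T) ^ (1 / α) with hb
  have hb0 : ∀ T, Tendsto (b T) atTop (𝓝 0) := by
    intro T
    have h1 : Tendsto (fun N : ℕ => lam * (T : ℝ) / (N + 1 : ℕ)) atTop (𝓝 0) :=
      (tendsto_const_div_atTop_nhds_zero_nat (lam * (T : ℝ))).comp (tendsto_add_atTop_nat 1)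
    have hc : Continuous fun x : ℝ => stableConst α m * (x ^ α * T) ^ (1 / α) :=
      continuous_const.mul ((Real.continuous_rpow_const (by positivity)).comp
        ((Real.continuous_rpow_const hα0.le).mul continuous_const))
    have h2 := (hc.tendsto 0).comp h1
    simpa [hb, Function.comp_def, Real.zero_rpow hα0.ne', Real.zero_rpow (inv_pos.2 hα0).ne']
      using h2
  obtain ⟨I, hI, hdist⟩ := exists_continuous_limit
    (f := fun n t => (hℓ.memLp_riemannSum hα hm hlam (n + 1) t).toLp)
    (fun n => hℓ.continuous_toLp_riemannSum hα hm hlam (n + 1)) hb0 (by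
      intro T t ht N n hNn
      have h := hℓ.eLpNorm_riemannSum_sub_le hα hm hlam N.succ_pos (Nat.succ_le_succ hNn) ht
      have hK := stableConst_pos hα hm
      rw [dist_eq_norm, ← MemLp.toLp_sub, Lp.norm_toLp]
      exact ENNReal.toReal_le_of_le_ofReal (by positivity) h)
  refine ⟨I, hI, fun t => ?_⟩
  rw [← tendsto_add_atTop_iff_nat 1]
  exact tendsto_iff_dist_tendsto_zero.2
    (squeeze_zero (fun _ => dist_nonneg) (hdist t t le_rfl) (hb0 t))

end StochIntegral

/-! ### The stochastic convolution as a continuous curve in `L^m` -/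

section StochConvolution

variable {Ω : Type*} [mΩ : MeasurableSpace Ω] {P : Measure Ω}
  {H : Type*} [NormedAddCommGroup H] [InnerProductSpace ℝ H]

/-- Limits in probability are almost surely unique. -/
lemma IsStochConvolution.ae_unique {e : HilbertBasis ℕ ℝ H} {lam β : ℕ → ℝ} {L : ℕ → ℝ≥0 → Ω → ℝ}
    {t : ℝ≥0} {Z Z' : Ω → H} (hZ : IsStochConvolution P e lam β L t Z)
    (hZ' : IsStochConvolution P e lam β L t Z') : Z =ᵐ[P] Z' := by
  obtain ⟨I, hI, hs⟩ := hZ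
  obtain ⟨I', hI', hs'⟩ := hZ'
  filter_upwards [ae_all_iff.2 fun k => tendstoInMeasure_ae_unique (hI k) (hI' k), hs, hs']
    with ω h1 h2 h3
  simp only [h1] at h2
  exact h2.unique h3

/-- The embedding `f ↦ f • x` of scalar into vector-valued `L^q` functions. -/
noncomputable def lpSmul (q : ℝ≥0∞) [Fact (1 ≤ q)] (P : Measure Ω) (x : H) :
    Lp ℝ q P →L[ℝ] Lp H q P :=
  (ContinuousLinearMap.toSpanSingleton ℝ x).compLpL q P

lemma coeFn_lpSmul {q : ℝ≥0∞} [Fact (1 ≤ q)] (x : H) (f : Lp ℝ q P) :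
    lpSmul q P x f =ᵐ[P] fun ω => f ω • x := by
  filter_upwards [(ContinuousLinearMap.toSpanSingleton ℝ x).coeFn_compLpL (p := q) (μ := P) f]
    with ω h
  rw [lpSmul, h, ContinuousLinearMap.toSpanSingleton_apply]

lemma coeFn_sum_smul_lpSmul {q : ℝ≥0∞} [Fact (1 ≤ q)] (F : Finset ℕ) (e : ℕ → H) (β : ℕ → ℝ)
    (f : ℕ → Lp ℝ q P) (g : ℕ → Ω → ℝ) (h : ∀ k, f k =ᵐ[P] g k) :
    (∑ k ∈ F, β k • lpSmul q P (e k) (f k) : Lp H q P) =ᵐ[P]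
      fun ω => ∑ k ∈ F, (β k * g k ω) • e k := by
  refine (Lp.coeFn_finsetSum _ _).trans ?_
  have h' : ∀ᵐ ω ∂P, ∀ k, (β k • lpSmul q P (e k) (f k) : Lp H q P) ω = (β k * g k ω) • e k := by
    refine ae_all_iff.2 fun k => ?_
    filter_upwards [Lp.coeFn_smul (β k) (lpSmul q P (e k) (f k)), coeFn_lpSmul (e k) (f k), h k]
      with ω h1 h2 h3
    rw [h1, Pi.smul_apply, h2, h3, smul_smul]
  filter_upwards [h'] with ω hω
  rw [Finset.sum_apply, Finset.sum_congr rfl fun k _ => hω k]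

variable [IsProbabilityMeasure P] {α m : ℝ} [CompleteSpace H]

/-- The stochastic convolution `t ↦ ∫₀ᵗ e^{(t-s)A} dL_s` is a bounded continuous adapted curve in
`L^m(Ω; H)` for every `m < α`. -/
lemma exists_stochConvolution [Fact (1 ≤ ENNReal.ofReal m)] (hα : α ∈ Ioo 1 2) (hm : m ∈ Ico 1 α)
    (𝓕 : Filtration ℝ≥0 mΩ) (e : HilbertBasis ℕ ℝ H) {lam β : ℕ → ℝ} (hlam : ∀ k, 0 < lam k)
    (hβ : ∀ k, 0 < β k) (hβlam : Summable fun k => β k ^ α / lam k) {L : ℕ → ℝ≥0 → Ω → ℝ}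
    (hL : IsCylindricalStable α 𝓕 P L) :
    ∃ (w : ℝ≥0 → Lp H (ENNReal.ofReal m) P) (M : ℝ), Continuous w ∧ (∀ t, ‖w t‖ ≤ M) ∧
      (∀ t, AEStronglyMeasurable[𝓕 t] (w t) P) ∧
      ∀ t, IsStochConvolution P e lam β L t (w t) := by
  have hα0 : 0 < α := by linarith [hα.1]
  have hm0 : 0 < m := by linarith [hm.1]
  have hK := stableConst_pos hα hm
  choose I hIc hIlim using fun k => exists_stochIntegral (hL.stable k) hα hm (hlam k)
  set c : ℕ → ℝ := fun k => β k ^ α * (1 / (α * lam k)) with hc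
  have hc0 : ∀ k, 0 ≤ c k := fun k => by have := hlam k; have := hβ k; positivity
  have hcs : Summable c := by
    refine (hβlam.mul_right (1 / α)).congr fun k => ?_
    have := (hlam k).ne'
    rw [hc]; field_simp
  -- the moment estimate passes from the Riemann sums to the limit
  have hbound : ∀ (F : Finset ℕ) (t : ℝ≥0) (σ : ℝ), ∑ k ∈ F, c k ≤ σ →
      ‖∑ k ∈ F, β k • lpSmul (ENNReal.ofReal m) P (e k) (I k t)‖ ≤ stableConst α m * σ ^
          (1 / α) := by
    intro F t σ hσ
    have hσ0 : 0 ≤ σ := (Finset.sum_nonneg fun k _ => hc0 k).trans hσ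
    have hlim : Tendsto (fun n => ∑ k ∈ F, β k • lpSmul (ENNReal.ofReal m) P (e k)
        ((hL.stable k).memLp_riemannSum hα hm (hlam k) n t).toLp) atTop
        (𝓝 (∑ k ∈ F, β k • lpSmul (ENNReal.ofReal m) P (e k) (I k t))) :=
      tendsto_finsetSum _ fun k _ =>
        (((lpSmul (ENNReal.ofReal m) P (e k)).continuous.tendsto _).comp (hIlim k t)).const_smul
            (β k)
    refine le_of_tendsto hlim.norm (Eventually.of_forall fun n => ?_)
    choose s hs0 hs1 hs using fun k => (hL.stable k).isStableVar_riemannSum hα (hlam k) n t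
    have h := eLpNorm_sum_smul_le e.orthonormal hα hm F (s := fun k => |β k| ^ α * s k)
      (Y := fun k ω => β k * riemannSum (L k) (lam k) n t ω) (P := P)
      (fun k _ => mul_nonneg (by positivity) (hs0 k)) (fun k _ => (hs k).const_mul (β k))
      (σ := σ) ((Finset.sum_le_sum fun k _ => by
        rw [abs_of_pos (hβ k)]
        have := hβ k
        have := hs1 k
        change _ ≤ c k
        rw [hc]
        dsimp only
        gcongr).trans hσ)
    rw [Lp.norm_def, eLpNorm_congr_ae (coeFn_sum_smul_lpSmul F e β _ _
      fun k => ((hL.stable k).memLp_riemannSum hα hm (hlam k) n t).coeFn_toLp)]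
    exact ENNReal.toReal_le_of_le_ofReal (by positivity) h
  -- the `N`-th tail of the series over the basis, uniformly in time
  set b : ℕ → ℝ := fun N => stableConst α m * (∑' k, c (k + N)) ^ (1 / α) with hb
  have hb0 : Tendsto b atTop (𝓝 0) := by
    have h1 := tendsto_sum_nat_add c
    have hcont : Continuous fun x : ℝ => stableConst α m * x ^ (1 / α) :=
      continuous_const.mul (Real.continuous_rpow_const (by positivity))
    have h2 := (hcont.tendsto 0).comp h1
    simpa [hb, Function.comp_def, Real.zero_rpow (inv_pos.2 hα0).ne'] using h2
  obtain ⟨w, hw, hdist⟩ := exists_continuous_limit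
    (f := fun n t => ∑ k ∈ Finset.range n, β k • lpSmul (ENNReal.ofReal m) P (e k) (I k t))
        (b := fun _ => b)
    (fun n => continuous_finsetSum _ fun k _ =>
      ((lpSmul (ENNReal.ofReal m) P (e k)).continuous.comp (hIc k)).const_smul (β k))
          (fun _ => hb0) (by
      intro T t _ N n hNn
      rw [dist_comm, dist_eq_norm, ← Finset.sum_sdiff (Finset.range_mono hNn), add_sub_cancel_right]
      refine hbound _ t _ ?_
      have h1 := hcs.sum_le_tsum (Finset.range n) fun k _ => hc0 k
      rw [← Finset.sum_sdiff (Finset.range_mono hNn), ← hcs.sum_add_tsum_nat_add N] at h1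
      linarith)
  have hlim : ∀ t, Tendsto (fun n => ∑ k ∈ Finset.range n, β k • lpSmul (ENNReal.ofReal m) P (e k)
      (I k t)) atTop
      (𝓝 (w t)) := fun t => tendsto_iff_dist_tendsto_zero.2
    (squeeze_zero (fun _ => dist_nonneg) (hdist t t le_rfl) hb0)
  refine ⟨w, stableConst α m * (∑' k, c k) ^ (1 / α), hw, fun t => ?_, fun t => ?_, fun t => ?_⟩
  · exact le_of_tendsto (hlim t).norm (Eventually.of_forall fun n =>
      hbound _ t _ (hcs.sum_le_tsum _ fun k _ => hc0 k))
  · have hIad : ∀ k, AEStronglyMeasurable[𝓕 t] (I k t) P := fun k => by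
      refine (isClosed_aestronglyMeasurable (𝓕.le t)).mem_of_tendsto (hIlim k t)
        (Eventually.of_forall fun n => ?_)
      refine AEStronglyMeasurable.congr ?_
        ((hL.stable k).memLp_riemannSum hα hm (hlam k) n t).coeFn_toLp.symm
      exact (measurable_riemannSum (m₀ := 𝓕 t) (fun s hs => ((hL.adapted k s).measurable).mono
        (𝓕.mono hs) le_rfl) (lam k) n).aestronglyMeasurable
    refine (isClosed_aestronglyMeasurable (𝓕.le t)).mem_of_tendsto (hlim t)
      (Eventually.of_forall fun n => ?_)
    refine mem_lpMeas_iff_aestronglyMeasurable.1 (Submodule.sum_mem (lpMeas H ℝ (𝓕 t) _ P)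
      fun k _ => Submodule.smul_mem _ _ (mem_lpMeas_iff_aestronglyMeasurable.2 ?_))
    exact ((hIad k).smul_const (e k)).congr (coeFn_lpSmul (e k) (I k t)).symm
  · refine ⟨fun k => I k t, fun k => ?_, ?_⟩
    · have hq0 : ENNReal.ofReal m ≠ 0 := by simpa using hm0
      refine tendstoInMeasure_of_tendsto_eLpNorm hq0
        (fun n => ((hL.stable k).memLp_riemannSum hα hm (hlam k) n t).1)
        (Lp.aestronglyMeasurable _) ?_
      have h1 := (Lp.tendsto_Lp_iff_tendsto_eLpNorm' _ _).1 (hIlim k t)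
      refine h1.congr fun n => eLpNorm_congr_ae ?_
      filter_upwards [((hL.stable k).memLp_riemannSum hα hm (hlam k) n t).coeFn_toLp] with ω hω
      rw [Pi.sub_apply, Pi.sub_apply, hω]
      rfl
    · -- the coordinates of `w t`, identified by continuity of the coordinate maps on `L^m`
      have hcoord : ∀ j, ∀ᵐ ω ∂P, inner ℝ (e j) (w t ω) = β j * I j t ω := by
        intro j
        have h1 : Tendsto (fun n => (innerSL ℝ (e j)).compLpL (ENNReal.ofReal m) P
            (∑ k ∈ Finset.range n, β k • lpSmul (ENNReal.ofReal m) P (e k) (I k t))) atTop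
            (𝓝 ((innerSL ℝ (e j)).compLpL (ENNReal.ofReal m) P (w t))) :=
          (((innerSL ℝ (e j)).compLpL (ENNReal.ofReal m) P).continuous.tendsto _).comp (hlim t)
        have h2 : ∀ n, j < n → (innerSL ℝ (e j)).compLpL (ENNReal.ofReal m) P
            (∑ k ∈ Finset.range n, β k • lpSmul (ENNReal.ofReal m) P (e k) (I k t)) = β j • I j
                t := by
          intro n hjn
          apply Lp.ext
          filter_upwards [(innerSL ℝ (e j)).coeFn_compLpL (p := ENNReal.ofReal m) (μ := P)
            (∑ k ∈ Finset.range n, β k • lpSmul (ENNReal.ofReal m) P (e k) (I k t)),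
            coeFn_sum_smul_lpSmul (Finset.range n) e β (fun k => I k t) (fun k => I k t)
              fun k => ae_eq_refl _, Lp.coeFn_smul (β j) (I j t)] with ω h3 h4 h5
          rw [h3, h4, h5, innerSL_apply_apply, inner_sum, Finset.sum_eq_single j]
          · simp [inner_smul_right, e.orthonormal.1 j]
          · intro k _ hkj
            rw [inner_smul_right, e.orthonormal.2 hkj.symm, mul_zero]
          · intro hj
            exact (hj (Finset.mem_range.2 hjn)).elim
        have h3 : (innerSL ℝ (e j)).compLpL (ENNReal.ofReal m) P (w t) = β j • I j t :=
          tendsto_nhds_unique h1 (tendsto_const_nhds.congr'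
            (eventually_atTop.2 ⟨j + 1, fun n hn => (h2 n hn).symm⟩))
        filter_upwards [(innerSL ℝ (e j)).coeFn_compLpL (p := ENNReal.ofReal m) (μ := P) (w t),
          Lp.coeFn_smul (β j) (I j t)] with ω h4 h5
        rw [h3, h5] at h4
        exact h4.symm
      filter_upwards [ae_all_iff.2 hcoord] with ω hω
      have := e.hasSum_repr (w t ω)
      simp only [e.repr_apply_apply, hω] at this
      exact this

end StochConvolution

/-! ### The semigroup on `H` and on `L^q(Ω; H)` -/

section Semigroup

variable {H : Type*} [NormedAddCommGroup H] [InnerProductSpace ℝ H]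

/-- Eigenvectors of the generator are eigenvectors of the semigroup: `e^{lam t} S_t x` has vanishing
right derivative. -/
lemma IsSemigroupGeneratedBy.apply_eigenvector {S : ℝ≥0 → H →L[ℝ] H} {A : H →ₗ.[ℝ] H}
    (hS : IsSemigroupGeneratedBy S A) {x : H} {lam : ℝ} (hx : (x, -lam • x) ∈ A.graph) (t : ℝ≥0) :
    S t x = Real.exp (-lam * t) • x := by
  have hgen := (hS.generator _ _).1 hx
  have hderiv : ∀ s : ℝ, 0 ≤ s → HasDerivWithinAt (fun r : ℝ => S r.toNNReal x)
      (-lam • S s.toNNReal x) (Ici s) s := by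
    intro s hs
    rw [← hasDerivWithinAt_Ioi_iff_Ici, hasDerivWithinAt_iff_tendsto_slope' (by simp)]
    have hsub : Tendsto (fun y : ℝ => (y - s).toNNReal) (𝓝[>] s) (𝓝[>] 0) := by
      refine tendsto_nhdsWithin_iff.2 ⟨?_, ?_⟩
      · have : Continuous fun y : ℝ => (y - s).toNNReal := by fun_prop
        have := (this.tendsto s).mono_left (nhdsWithin_le_nhds (s := Ioi s))
        simpa using this
      · filter_upwards [self_mem_nhdsWithin] with y hy
        exact Real.toNNReal_pos.2 (sub_pos.2 hy)
    have h1 := ((S s.toNNReal).continuous.tendsto _).comp (hgen.comp hsub)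
    rw [map_smul] at h1
    refine h1.congr' ?_
    filter_upwards [self_mem_nhdsWithin] with y hy
    have hys : 0 ≤ y - s := (sub_pos.2 hy).le
    have h2 : S y.toNNReal x = S s.toNNReal (S (y - s).toNNReal x) := by
      rw [← ContinuousLinearMap.comp_apply, ← hS.map_add, ← Real.toNNReal_add hs hys,
        add_sub_cancel]
    simp only [Function.comp_apply, map_smul, map_sub, slope, vsub_eq_sub, h2,
      Real.coe_toNNReal _ hys]
  have hconst := constant_of_has_deriv_right_zero
    (f := fun s : ℝ => Real.exp (lam * s) • S s.toNNReal x) (a := 0) (b := t)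
    (by
      have := hS.continuous x
      have h2 : Continuous fun s : ℝ => S s.toNNReal x := this.comp continuous_real_toNNReal
      fun_prop)
    (by
      intro s hs
      have he : HasDerivWithinAt (fun s : ℝ => Real.exp (lam * s)) (Real.exp (lam * s) * lam)
          (Ici s) s := by
        simpa using (((hasDerivAt_id s).const_mul lam).exp).hasDerivWithinAt
      refine (he.smul (hderiv s hs.1)).congr_deriv ?_
      rw [smul_smul, ← add_smul]
      simp)
    t ⟨t.2, le_rfl⟩
  simp only [mul_zero, Real.exp_zero, one_smul, Real.toNNReal_zero, hS.map_zero,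
    Real.toNNReal_coe, ContinuousLinearMap.id_apply] at hconst
  rw [neg_mul, Real.exp_neg, ← hconst, smul_smul, inv_mul_cancel₀ (Real.exp_pos _).ne', one_smul]
  rw [hconst]

/-- A semigroup with an orthonormal basis of eigenvectors of nonpositive eigenvalues is
contractive. -/
lemma IsSemigroupGeneratedBy.norm_apply_le {S : ℝ≥0 → H →L[ℝ] H} {A : H →ₗ.[ℝ] H}
    (hS : IsSemigroupGeneratedBy S A) (e : HilbertBasis ℕ ℝ H) {lam : ℕ → ℝ}
    (hAe : ∀ k, (e k, -lam k • e k) ∈ A.graph) (hlam : ∀ k, 0 < lam k) (t : ℝ≥0) (x : H) :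
    ‖S t x‖ ≤ ‖x‖ := by
  have h1 := e.hasSum_repr x
  have h2 := h1.mapL (S t)
  refine le_of_tendsto_of_tendsto' h2.norm h1.norm fun F => ?_
  have hsq : ∀ c : ℕ → ℝ, ‖∑ k ∈ F, c k • e k‖ ^ 2 = ∑ k ∈ F, c k ^ 2 := fun c => by
    rw [← real_inner_self_eq_norm_sq, e.orthonormal.inner_sum]
    simp [sq]
  refine le_of_sq_le_sq ?_ (norm_nonneg _)
  have h3 : ∑ k ∈ F, S t (e.repr x k • e k)
      = ∑ k ∈ F, (e.repr x k * Real.exp (-lam k * t)) • e k := by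
    refine Finset.sum_congr rfl fun k _ => ?_
    rw [map_smul, hS.apply_eigenvector (hAe k), smul_smul]
  rw [h3, hsq, hsq]
  refine Finset.sum_le_sum fun k _ => ?_
  have h4 : Real.exp (-lam k * t) ≤ 1 := by
    rw [Real.exp_le_one_iff]
    nlinarith [hlam k, t.coe_nonneg]
  rw [mul_pow]
  have h5 := pow_le_one₀ (n := 2) (Real.exp_pos (-lam k * t)).le h4
  nlinarith [sq_nonneg (e.repr x k)]

/-- A strongly continuous family of contractions is jointly continuous. -/
lemma continuous_uncurry_of_contraction {E : Type*} [NormedAddCommGroup E] [NormedSpace ℝ E]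
    {S : ℝ≥0 → E →L[ℝ] E} (hS : ∀ x, Continuous fun t => S t x) (hS1 : ∀ t x, ‖S t x‖ ≤ ‖x‖) :
    Continuous fun z : ℝ≥0 × E => S z.1 z.2 := by
  refine continuous_iff_continuousAt.2 fun ⟨t, x⟩ => ?_
  rw [ContinuousAt, tendsto_iff_dist_tendsto_zero]
  have h1 : Tendsto (fun z : ℝ≥0 × E => ‖z.2 - x‖ + ‖S z.1 x - S t x‖) (𝓝 (t, x)) (𝓝 0) := by
    have hc : Continuous fun z : ℝ≥0 × E => ‖z.2 - x‖ + ‖S z.1 x - S t x‖ := by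
      have := (hS x).comp (continuous_fst (X := ℝ≥0) (Y := E))
      simp only [Function.comp_def] at this
      fun_prop
    simpa using hc.tendsto (t, x)
  refine squeeze_zero (fun _ => dist_nonneg) (fun z => ?_) h1
  rw [dist_eq_norm]
  calc ‖S z.1 z.2 - S t x‖ = ‖S z.1 (z.2 - x) + (S z.1 x - S t x)‖ := by rw [map_sub]; abel_nf
    _ ≤ _ := (norm_add_le _ _).trans (by gcongr; exact hS1 _ _)

/-- Strong continuity passes to `L^q(Ω; H)`, by dominated convergence. -/
lemma continuous_compLpL {Ω : Type*} [MeasurableSpace Ω] {P : Measure Ω} {m : ℝ}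
    [Fact (1 ≤ ENNReal.ofReal m)] {S : ℝ≥0 → H →L[ℝ] H} (hS : ∀ x, Continuous fun t => S t x)
    (hS1 : ∀ t x, ‖S t x‖ ≤ ‖x‖) (f : Lp H (ENNReal.ofReal m) P) :
    Continuous fun t => (S t).compLpL (ENNReal.ofReal m) P f := by
  have hq : 1 ≤ ENNReal.ofReal m := Fact.out
  have hm0 : 0 < m := by
    have := zero_lt_one.trans_le hq
    simpa using this
  have hq0 : ENNReal.ofReal m ≠ 0 := (zero_lt_one.trans_le hq).ne'
  refine continuous_iff_continuousAt.2 fun t => ?_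
  rw [ContinuousAt, Lp.tendsto_Lp_iff_tendsto_eLpNorm']
  have heq : ∀ s, eLpNorm ((S s).compLpL (ENNReal.ofReal m) P f -
      (S t).compLpL (ENNReal.ofReal m) P f : Ω → H) (ENNReal.ofReal m) P
      = (∫⁻ ω, ‖S s (f ω) - S t (f ω)‖ₑ ^ m ∂P) ^ (1 / m) := by
    intro s
    rw [eLpNorm_congr_ae (((S s).coeFn_compLpL f).sub ((S t).coeFn_compLpL f)),
      eLpNorm_eq_lintegral_rpow_enorm_toReal hq0 ENNReal.ofReal_ne_top,
      ENNReal.toReal_ofReal hm0.le]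
    rfl
  simp_rw [heq]
  have hbound : ∫⁻ ω, (2 * ‖f ω‖ₑ) ^ m ∂P ≠ ∞ := by
    have h := lintegral_rpow_enorm_lt_top_of_eLpNorm_lt_top hq0 ENNReal.ofReal_ne_top
      (Lp.eLpNorm_lt_top f)
    rw [ENNReal.toReal_ofReal hm0.le] at h
    simp_rw [ENNReal.mul_rpow_of_nonneg _ _ hm0.le]
    rw [lintegral_const_mul' _ _ (by finiteness)]
    finiteness
  have h0 : Tendsto (fun s => ∫⁻ ω, ‖S s (f ω) - S t (f ω)‖ₑ ^ m ∂P) (𝓝 t) (𝓝 (∫⁻ _, 0 ∂P)) := by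
    refine tendsto_lintegral_filter_of_dominated_convergence' (fun ω => (2 * ‖f ω‖ₑ) ^ m)
      (Eventually.of_forall fun s => ?_) (Eventually.of_forall fun s => ae_of_all _ fun ω => ?_)
      hbound (ae_of_all _ fun ω => ?_)
    · exact ((((S s).continuous.comp_aestronglyMeasurable (Lp.aestronglyMeasurable f)).sub
        ((S t).continuous.comp_aestronglyMeasurable (Lp.aestronglyMeasurable f))).enorm).pow_const m
    · refine ENNReal.rpow_le_rpow ?_ hm0.le
      refine enorm_sub_le.trans ?_
      rw [two_mul]
      have h1 : ∀ r, ‖S r (f ω)‖ₑ ≤ ‖f ω‖ₑ := fun r => by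
        rw [enorm_le_iff_norm_le]; exact hS1 r _
      exact add_le_add (h1 s) (h1 t)
    · have hc : Continuous fun s => ‖S s (f ω) - S t (f ω)‖ₑ ^ m :=
        (ENNReal.continuous_rpow_const).comp (((hS (f ω)).sub continuous_const).enorm)
      simpa [hm0] using hc.tendsto t
  rw [lintegral_zero] at h0
  have h1 := ((ENNReal.continuous_rpow_const (y := 1 / m)).tendsto 0).comp h0
  simpa [Function.comp_def, hm0] using h1

end Semigroup

/-! ### The Wasserstein distance of laws and the drift as a Lipschitz map of `L^m(Ω; H)` -/

section Drift

variable {H : Type*} [NormedAddCommGroup H] [MeasurableSpace H] [BorelSpace H]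
  [SecondCountableTopology H] {p : ℝ}

/-- The joint law of `X` and `Y` is a coupling of their laws. -/
lemma wasserstein_lawOf_le {Ω : Type*} [MeasurableSpace Ω] {P : Measure Ω} [IsProbabilityMeasure P]
    {X Y : Ω → H} (hX : AEMeasurable X P) (hY : AEMeasurable Y P)
    (hXp : ∫⁻ ω, ‖X ω‖ₑ ^ p ∂P < ∞) (hYp : ∫⁻ ω, ‖Y ω‖ₑ ^ p ∂P < ∞) :
    wasserstein (lawOf X hX hXp) (lawOf Y hY hYp) ≤ (∫⁻ ω, ‖X ω - Y ω‖ₑ ^ p ∂P) ^ (1 / p) := by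
  have hXY : AEMeasurable (fun ω => (X ω, Y ω)) P := hX.prodMk hY
  have hcoup : IsCoupling (P.map fun ω => (X ω, Y ω)) (P.map X) (P.map Y) :=
    ⟨AEMeasurable.map_map_of_aemeasurable measurable_fst.aemeasurable hXY,
      AEMeasurable.map_map_of_aemeasurable measurable_snd.aemeasurable hXY⟩
  refine (iInf₂_le (P.map fun ω => (X ω, Y ω)) hcoup).trans_eq ?_
  rw [lintegral_map' (by fun_prop) hXY]

lemma wasserstein_self (hp : 0 < p) (μ : FiniteMomentMeasure H p) : wasserstein μ μ = 0 := by
  have hdiag : Measurable fun x : H => (x, x) := by fun_prop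
  have hcoup : IsCoupling ((μ.1 : Measure H).map fun x => (x, x)) (μ.1 : Measure H)
      (μ.1 : Measure H) :=
    ⟨(Measure.map_map measurable_fst hdiag).trans Measure.map_id,
      (Measure.map_map measurable_snd hdiag).trans Measure.map_id⟩
  refine le_antisymm ((iInf₂_le ((μ.1 : Measure H).map fun x => (x, x)) hcoup).trans_eq ?_)
    zero_le
  rw [lintegral_map (by fun_prop) hdiag]
  simp [hp]

omit [SecondCountableTopology H] in
lemma lawOf_congr {Ω : Type*} [MeasurableSpace Ω] {P : Measure Ω} [IsProbabilityMeasure P]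
    {X Y : Ω → H} (hX : AEMeasurable X P) (hY : AEMeasurable Y P)
    (hXp : ∫⁻ ω, ‖X ω‖ₑ ^ p ∂P < ∞) (hYp : ∫⁻ ω, ‖Y ω‖ₑ ^ p ∂P < ∞) (h : X =ᵐ[P] Y) :
    lawOf X hX hXp = lawOf Y hY hYp :=
  Subtype.ext (Subtype.ext (Measure.map_congr h))

variable {C : ℝ≥0} {B : H → FiniteMomentMeasure H p → H}

lemma lipschitzWith_drift (hp : 0 < p)
    (hB : ∀ x y μ ν, ‖B x μ - B y ν‖ₑ ≤ C * (‖x - y‖ₑ + wasserstein μ ν))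
    (μ : FiniteMomentMeasure H p) : LipschitzWith C fun x => B x μ := by
  intro x y
  have := hB x y μ μ
  rwa [wasserstein_self hp, add_zero, ← edist_eq_enorm_sub, ← edist_eq_enorm_sub] at this

variable {Ω : Type*} [mΩ : MeasurableSpace Ω] {P : Measure Ω} [IsProbabilityMeasure P] {m : ℝ}

omit [MeasurableSpace H] [BorelSpace H] [SecondCountableTopology H] in
lemma moment_lt_top_of_memLp (hp : 0 < p) (hpm : p ≤ m) {X : Ω → H}
    (hX : MemLp X (ENNReal.ofReal m) P) : ∫⁻ ω, ‖X ω‖ₑ ^ p ∂P < ∞ := by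
  have h := lintegral_rpow_enorm_lt_top_of_eLpNorm_lt_top (by simpa using hp) ENNReal.ofReal_ne_top
    (hX.mono_exponent (ENNReal.ofReal_le_ofReal hpm)).2
  rwa [ENNReal.toReal_ofReal hp.le] at h

omit [MeasurableSpace H] [BorelSpace H] [SecondCountableTopology H]
  [IsProbabilityMeasure P] in
lemma eLpNorm_ofReal_eq (hm : 0 < m) (X : Ω → H) :
    eLpNorm X (ENNReal.ofReal m) P = (∫⁻ ω, ‖X ω‖ₑ ^ m ∂P) ^ (1 / m) := by
  rw [eLpNorm_eq_lintegral_rpow_enorm_toReal (by simpa using hm) ENNReal.ofReal_ne_top,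
    ENNReal.toReal_ofReal hm.le]

omit [SecondCountableTopology H] [IsProbabilityMeasure P] in
lemma aemeasurable_lp (U : Lp H (ENNReal.ofReal m) P) : AEMeasurable U P :=
  (Lp.aestronglyMeasurable U).aemeasurable

/-- The law of an element of `L^m(Ω; H)`, `m ≥ p`, as a measure with finite `p`-th moment. -/
noncomputable def lpLaw (hp : 0 < p) (hpm : p ≤ m) (U : Lp H (ENNReal.ofReal m) P) :
    FiniteMomentMeasure H p :=
  lawOf U (aemeasurable_lp U) (moment_lt_top_of_memLp hp hpm (Lp.memLp U))

lemma wasserstein_lpLaw_le (hp : 0 < p) (hpm : p ≤ m) (U V : Lp H (ENNReal.ofReal m) P) :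
    wasserstein (lpLaw hp hpm U) (lpLaw hp hpm V) ≤ ENNReal.ofReal ‖U - V‖ := by
  refine (wasserstein_lawOf_le _ _ _ _).trans ?_
  have h1 := eLpNorm_ofReal_eq (P := P) hp fun ω => U ω - V ω
  rw [← h1]
  refine (eLpNorm_le_eLpNorm_of_exponent_le (ENNReal.ofReal_le_ofReal hpm)
    ((Lp.aestronglyMeasurable U).sub (Lp.aestronglyMeasurable V))).trans_eq ?_
  rw [Lp.norm_def, ENNReal.ofReal_toReal (Lp.eLpNorm_ne_top _)]
  exact eLpNorm_congr_ae (Lp.coeFn_sub U V).symm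

lemma memLp_drift (hp : 0 < p)
    (hB : ∀ x y μ ν, ‖B x μ - B y ν‖ₑ ≤ C * (‖x - y‖ₑ + wasserstein μ ν))
    {X : Ω → H} (hX : MemLp X (ENNReal.ofReal m) P) (μ : FiniteMomentMeasure H p) :
    MemLp (fun ω => B (X ω) μ) (ENNReal.ofReal m) P := by
  have hlip := lipschitzWith_drift hp hB μ
  have h1 : LipschitzWith C fun x => B x μ - B 0 μ := fun x y => by
    simpa [edist_eq_enorm_sub] using hlip x y
  have h2 := (h1.comp_memLp (by simp) hX).add (memLp_const (B 0 μ))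
  refine h2.congr_norm ?_ (ae_of_all _ fun ω => by simp)
  exact hlip.continuous.comp_aestronglyMeasurable hX.1

/-- The drift `X ↦ B(X, Law X)` as a map of `L^m(Ω; H)`. -/
noncomputable def lpDrift (hp : 0 < p) (hpm : p ≤ m)
    (hB : ∀ x y μ ν, ‖B x μ - B y ν‖ₑ ≤ C * (‖x - y‖ₑ + wasserstein μ ν))
    (U : Lp H (ENNReal.ofReal m) P) : Lp H (ENNReal.ofReal m) P :=
  (memLp_drift hp hB (Lp.memLp U) (lpLaw hp hpm U)).toLp

lemma coeFn_lpDrift (hp : 0 < p) (hpm : p ≤ m)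
    (hB : ∀ x y μ ν, ‖B x μ - B y ν‖ₑ ≤ C * (‖x - y‖ₑ + wasserstein μ ν))
    (U : Lp H (ENNReal.ofReal m) P) :
    lpDrift hp hpm hB U =ᵐ[P] fun ω => B (U ω) (lpLaw hp hpm U) :=
  MemLp.coeFn_toLp _

lemma norm_lpDrift_sub_le (hp : 0 < p) (hpm : p ≤ m) [Fact (1 ≤ ENNReal.ofReal m)]
    (hB : ∀ x y μ ν, ‖B x μ - B y ν‖ₑ ≤ C * (‖x - y‖ₑ + wasserstein μ ν))
    (U V : Lp H (ENNReal.ofReal m) P) :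
    ‖lpDrift hp hpm hB U - lpDrift hp hpm hB V‖ ≤ 2 * C * ‖U - V‖ := by
  have hq : 1 ≤ ENNReal.ofReal m := Fact.out
  set μ := lpLaw hp hpm U
  set ν := lpLaw hp hpm V
  have hUμ := memLp_drift hp hB (Lp.memLp U) μ
  have hVμ := memLp_drift hp hB (Lp.memLp V) μ
  have hVν := memLp_drift hp hB (Lp.memLp V) ν
  have hsplit : lpDrift hp hpm hB U - lpDrift hp hpm hB V
      = (hUμ.sub hVμ).toLp + (hVμ.sub hVν).toLp := by
    rw [MemLp.toLp_sub hUμ hVμ, MemLp.toLp_sub hVμ hVν, sub_add_sub_cancel]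
    rfl
  have h1 : ‖(hUμ.sub hVμ).toLp‖ ≤ C * ‖U - V‖ := by
    refine Lp.norm_le_mul_norm_of_ae_le_mul ?_
    filter_upwards [(hUμ.sub hVμ).coeFn_toLp, Lp.coeFn_sub U V] with ω h2 h3
    rw [h2, h3]
    have := (lipschitzWith_drift hp hB μ).dist_le_mul (U ω) (V ω)
    rwa [dist_eq_norm, dist_eq_norm] at this
  have h2 : ‖(hVμ.sub hVν).toLp‖ ≤ C * ‖U - V‖ := by
    rw [Lp.norm_toLp]
    refine ENNReal.toReal_le_of_le_ofReal (by positivity) ?_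
    have h3 : ∀ ω, ‖B (V ω) μ - B (V ω) ν‖ ≤ C * ‖U - V‖ := by
      intro ω
      have h4 := hB (V ω) (V ω) μ ν
      rw [sub_self, enorm_zero, zero_add] at h4
      have h5 := h4.trans (mul_le_mul_right (wasserstein_lpLaw_le hp hpm U V) (C : ℝ≥0∞))
      rw [← ENNReal.ofReal_coe_nnreal, ← ENNReal.ofReal_mul C.coe_nonneg, ← ofReal_norm] at h5
      exact (ENNReal.ofReal_le_ofReal_iff (by positivity)).1 h5
    have h6 := eLpNorm_le_of_ae_bound (p := ENNReal.ofReal m) (μ := P) (ae_of_all _ h3)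
    rw [measure_univ, ENNReal.one_rpow, one_mul] at h6
    exact h6
  rw [hsplit]
  calc _ ≤ _ := norm_add_le _ _
    _ ≤ C * ‖U - V‖ + C * ‖U - V‖ := add_le_add h1 h2
    _ = _ := by ring

end Drift

/-! ### A Grönwall inequality and semilinear Volterra equations in a Banach space -/

section Volterra

lemma mul_integral_exp_le {κ : ℝ} (hκ : 0 < κ) (t : ℝ) :
    κ * ∫ s in (0 : ℝ)..t, Real.exp (2 * κ * s) ≤ Real.exp (2 * κ * t) / 2 := by
  have h1 : ∫ s in (0 : ℝ)..t, Real.exp (2 * κ * s)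
      = (2 * κ)⁻¹ * (Real.exp (2 * κ * t) - Real.exp (2 * κ * 0)) := by
    rw [intervalIntegral.integral_comp_mul_left (fun x => Real.exp x) (by positivity : 2 * κ ≠ 0),
      integral_exp, smul_eq_mul]
  rw [h1, mul_zero, Real.exp_zero]
  have h2 : κ * ((2 * κ)⁻¹ * (Real.exp (2 * κ * t) - 1)) = (Real.exp (2 * κ * t) - 1) / 2 := by
    field_simp
  rw [h2]
  linarith

/-- **Grönwall's inequality** for extended nonnegative functions that are a priori only integrable.
The weight `e^{-2κt}` turns the integral operator into a contraction of factor `1/2`. -/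
lemma le_of_le_add_mul_lintegral {f : ℝ≥0 → ℝ≥0∞} {a : ℝ≥0∞} {κ : ℝ} (hκ : 0 < κ) {T : ℝ≥0}
    (ha : a ≠ ∞) (hint : ∫⁻ s in Icc (0 : ℝ) T, f s.toNNReal ≠ ∞)
    (h : ∀ t ≤ T, f t ≤ a + ENNReal.ofReal κ * ∫⁻ s in Icc (0 : ℝ) t, f s.toNNReal) :
    ∀ t ≤ T, f t ≤ 2 * a * ENNReal.ofReal (Real.exp (2 * κ * t)) := by
  set E : ℝ → ℝ≥0∞ := fun t => ENNReal.ofReal (Real.exp (2 * κ * t)) with hE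
  have hE0 : ∀ t, E t ≠ 0 := fun t => by simp [hE, Real.exp_pos]
  have hEtop : ∀ t, E t ≠ ∞ := fun t => ENNReal.ofReal_ne_top
  have hE1 : ∀ t : ℝ≥0, 1 ≤ E t := fun t => by
    rw [hE, ENNReal.one_le_ofReal]
    exact Real.one_le_exp (by positivity)
  -- the weighted supremum; it is finite because `f` is integrable, so `G ≤ a + G / 2` can be solved
  set G : ℝ≥0∞ := ⨆ t ∈ Iic T, f t / E t with hG
  have hfG : ∀ t ≤ T, f t ≤ G * E t := fun t ht => by
    rw [← ENNReal.div_le_iff (hE0 t) (hEtop t)]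
    exact le_iSup₂_of_le t ht le_rfl
  have hGtop : G ≠ ∞ := by
    have hle : G ≤ a + ENNReal.ofReal κ * ∫⁻ s in Icc (0 : ℝ) T, f s.toNNReal := by
      refine iSup₂_le fun t ht => ?_
      refine (ENNReal.div_le_of_le_mul ?_ : _ ≤ f t).trans ((h t ht).trans ?_)
      · exact le_mul_of_one_le_right' (hE1 t)
      · gcongr
        exact ht
    exact ne_top_of_le_ne_top (by finiteness) hle
  have hhalf : G ≤ a + G / 2 := by
    refine iSup₂_le fun t ht => ?_
    rw [ENNReal.div_le_iff (hE0 t) (hEtop t)]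
    have h1 : ∫⁻ s in Icc (0 : ℝ) t, f s.toNNReal ≤ G * ∫⁻ s in Icc (0 : ℝ) t, E s := by
      rw [← lintegral_const_mul' _ _ hGtop]
      refine setLIntegral_mono' measurableSet_Icc fun s hs => ?_
      have := hfG s.toNNReal (Real.toNNReal_le_iff_le_coe.2 (hs.2.trans (NNReal.coe_le_coe.2 ht)))
      rwa [Real.coe_toNNReal _ hs.1] at this
    have h2 : ENNReal.ofReal κ * ∫⁻ s in Icc (0 : ℝ) t, E s ≤ E t / 2 := by
      have hcont : Continuous fun s : ℝ => Real.exp (2 * κ * s) := by fun_prop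
      rw [← ofReal_integral_eq_lintegral_ofReal (hcont.integrableOn_Icc)
        (ae_of_all _ fun s => (Real.exp_pos _).le), integral_Icc_eq_integral_Ioc,
        ← intervalIntegral.integral_of_le t.coe_nonneg, ← ENNReal.ofReal_mul hκ.le]
      refine (ENNReal.ofReal_le_ofReal (mul_integral_exp_le hκ t)).trans_eq ?_
      rw [ENNReal.ofReal_div_of_pos two_pos, ENNReal.ofReal_ofNat]
    calc f t ≤ a + ENNReal.ofReal κ * ∫⁻ s in Icc (0 : ℝ) t, f s.toNNReal := h t ht
      _ ≤ a * E t + ENNReal.ofReal κ * (G * ∫⁻ s in Icc (0 : ℝ) t, E s) := by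
          gcongr
          exact le_mul_of_one_le_right' (hE1 t)
      _ = a * E t + G * (ENNReal.ofReal κ * ∫⁻ s in Icc (0 : ℝ) t, E s) := by ring
      _ ≤ a * E t + G * (E t / 2) := by gcongr
      _ = (a + G / 2) * E t := by rw [add_mul, div_eq_mul_inv, div_eq_mul_inv]; ring
  have hG2 : G ≤ 2 * a := by
    clear_value G
    clear hG
    lift G to ℝ≥0 using hGtop
    lift a to ℝ≥0 using ha
    have h3 : G ≤ a + G / 2 := by exact_mod_cast hhalf
    have h4 : G ≤ 2 * a := by
      rw [← NNReal.coe_le_coe] at h3 ⊢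
      push_cast at h3 ⊢
      linarith
    exact_mod_cast h4
  intro t ht
  exact (hfG t ht).trans (by gcongr)

variable {E : Type*} [NormedAddCommGroup E] [NormedSpace ℝ E]

lemma intervalIntegral_mem_of_isClosed [CompleteSpace E] (F : Submodule ℝ E)
    (hF : IsClosed (F : Set E))
    {f : ℝ → E} {a b : ℝ} (hab : a ≤ b) (hf : ∀ s ∈ Ioc a b, f s ∈ F)
    (hint : IntervalIntegrable f volume a b) : ∫ s in a..b, f s ∈ F := by
  have : IsClosed (F : Set E) := hF
  rw [← Submodule.Quotient.mk_eq_zero, ← Submodule.mkQ_apply, ← Submodule.mkQL_apply,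
    ← ContinuousLinearMap.intervalIntegral_comp_comm _ hint,
    intervalIntegral.integral_of_le hab, setIntegral_congr_fun (g := fun _ => 0) measurableSet_Ioc,
    integral_zero]
  intro s hs
  simpa using hf s hs

variable {T : ℝ≥0 → E →L[ℝ] E} {b : E → E}

lemma continuous_volterra_integrand (hT : Continuous fun z : ℝ≥0 × E => T z.1 z.2)
    (hb : Continuous b) {u : ℝ≥0 → E} (hu : Continuous u) :
    Continuous fun z : ℝ≥0 × ℝ => T (z.1 - z.2.toNNReal) (b (u z.2.toNNReal)) := by
  have h1 : Continuous fun z : ℝ≥0 × ℝ => (z.1 - z.2.toNNReal, b (u z.2.toNNReal)) := by fun_prop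
  exact hT.comp h1

lemma continuous_volterra_integral (hT : Continuous fun z : ℝ≥0 × E => T z.1 z.2)
    (hb : Continuous b) {u : ℝ≥0 → E} (hu : Continuous u) :
    Continuous fun t : ℝ≥0 => ∫ s in (0 : ℝ)..t, T (t - s.toNNReal) (b (u s.toNNReal)) :=
  intervalIntegral.continuous_parametric_intervalIntegral_of_continuous
    (continuous_volterra_integrand hT hb hu) NNReal.continuous_coe

lemma intervalIntegrable_volterra (hT : Continuous fun z : ℝ≥0 × E => T z.1 z.2)
    (hb : Continuous b) {u : ℝ≥0 → E} (hu : Continuous u) (t : ℝ≥0) :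
    IntervalIntegrable (fun s : ℝ => T (t - s.toNNReal) (b (u s.toNNReal))) volume 0 t :=
  ((continuous_volterra_integrand hT hb hu).comp (by fun_prop : Continuous fun s : ℝ => (t, s))
    ).intervalIntegrable _ _

lemma norm_volterra_sub_le [CompleteSpace E] (hT : Continuous fun z : ℝ≥0 × E => T z.1 z.2)
    (hT1 : ∀ t x, ‖T t x‖ ≤ ‖x‖) (hb : Continuous b) {κ : ℝ}
    (hbκ : ∀ x y, ‖b x - b y‖ ≤ κ * ‖x - y‖) (hκ : 0 ≤ κ) {u v : ℝ≥0 → E} (hu : Continuous u)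
    (hv : Continuous v) (t : ℝ≥0) {g : ℝ → ℝ} (hg : Continuous g)
    (huv : ∀ s ≤ t, ‖u s - v s‖ ≤ g s) :
    ‖(∫ s in (0 : ℝ)..t, T (t - s.toNNReal) (b (u s.toNNReal))) -
      ∫ s in (0 : ℝ)..t, T (t - s.toNNReal) (b (v s.toNNReal))‖ ≤ κ * ∫ s in (0 : ℝ)..t, g s := by
  rw [← intervalIntegral.integral_sub (intervalIntegrable_volterra hT hb hu t)
    (intervalIntegrable_volterra hT hb hv t), ← intervalIntegral.integral_const_mul]
  refine intervalIntegral.norm_integral_le_of_norm_le t.coe_nonneg (ae_of_all _ fun s hs => ?_)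
    ((continuous_const.mul hg).intervalIntegrable _ _)
  rw [← map_sub]
  refine (hT1 _ _).trans ((hbκ _ _).trans ?_)
  have := huv s.toNNReal (Real.toNNReal_le_iff_le_coe.2 hs.2)
  rw [Real.coe_toNNReal _ hs.1.le] at this
  gcongr

/-- The semilinear Volterra equation `u(t) = a(t) + ∫₀ᵗ T_{t-s} b(u(s)) ds` with Lipschitz `b` has a
continuous solution, by Picard iteration. If the data respect an increasing family of closed
subspaces (in the application, of random variables measurable up to time `t`), so does the
solution. -/
theorem exists_volterra_solution [CompleteSpace E]
    (hT : Continuous fun z : ℝ≥0 × E => T z.1 z.2)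
    (hT1 : ∀ t x, ‖T t x‖ ≤ ‖x‖) {κ : ℝ} (hκ : 0 < κ) (hbκ : ∀ x y, ‖b x - b y‖ ≤ κ * ‖x - y‖)
    {a : ℝ≥0 → E} (ha : Continuous a) (𝒦 : ℝ≥0 → Submodule ℝ E)
    (h𝒦 : ∀ t, IsClosed (𝒦 t : Set E)) (hmono : Monotone 𝒦) (ha𝒦 : ∀ t, a t ∈ 𝒦 t)
    (hT𝒦 : ∀ s t, ∀ x ∈ 𝒦 s, T t x ∈ 𝒦 s) (hb𝒦 : ∀ t, ∀ x ∈ 𝒦 t, b x ∈ 𝒦 t) :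
    ∃ u : ℝ≥0 → E, Continuous u ∧ (∀ t, u t ∈ 𝒦 t) ∧
      ∀ t, u t = a t + ∫ s in (0 : ℝ)..t, T (t - s.toNNReal) (b (u s.toNNReal)) := by
  have hb : Continuous b := by
    refine (LipschitzWith.of_dist_le_mul (K := κ.toNNReal) fun x y => ?_).continuous
    rw [dist_eq_norm, dist_eq_norm, Real.coe_toNNReal _ hκ.le]
    exact hbκ x y
  set Φ : (ℝ≥0 → E) → ℝ≥0 → E := fun u t =>
    a t + ∫ s in (0 : ℝ)..t, T (t - s.toNNReal) (b (u s.toNNReal)) with hΦ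
  set U : ℕ → ℝ≥0 → E := fun n => Φ^[n] a with hU
  have hU1 : ∀ n, U (n + 1) = Φ (U n) := fun n => Function.iterate_succ_apply' Φ n a
  have hUc : ∀ n, Continuous (U n) := by
    intro n
    induction n with
    | zero => exact ha
    | succ n ih => rw [hU1]; exact ha.add (continuous_volterra_integral hT hb ih)
  have hU𝒦 : ∀ n t, U n t ∈ 𝒦 t := by
    intro n
    induction n with
    | zero => exact ha𝒦
    | succ n ih =>
      intro t
      rw [hU1]
      refine (𝒦 t).add_mem (ha𝒦 t) (intervalIntegral_mem_of_isClosed _ (h𝒦 t) t.coe_nonneg ?_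
        (intervalIntegrable_volterra hT hb (hUc n) t))
      intro s hs
      refine hT𝒦 _ _ _ (hb𝒦 _ _ (hmono ?_ (ih s.toNNReal)))
      exact Real.toNNReal_le_iff_le_coe.2 hs.2
  -- a bound for the first Picard step on `[0, R]`
  have hM : ∀ R : ℝ≥0, ∃ M, 0 ≤ M ∧ ∀ t ≤ R, ‖U 1 t - U 0 t‖ ≤ M := by
    intro R
    obtain ⟨M, hM⟩ := (isCompact_Icc (a := (0 : ℝ≥0)) (b := R)).exists_bound_of_continuousOn
      ((hUc 1).sub (hUc 0)).continuousOn
    exact ⟨M, (norm_nonneg _).trans (hM 0 ⟨le_rfl, zero_le⟩), fun t ht => hM t ⟨zero_le, ht⟩⟩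
  choose M hM0 hM using hM
  -- the Picard map contracts by `1/2` in the norm with weight `e^{-2κt}`
  have hstep : ∀ R n, ∀ t ≤ R, ‖U (n + 1) t - U n t‖ ≤
      M R * (1 / 2) ^ n * Real.exp (2 * κ * t) := by
    intro R n
    induction n with
    | zero =>
      intro t ht
      rw [pow_zero, mul_one]
      exact (hM R t ht).trans (le_mul_of_one_le_right (hM0 R) (Real.one_le_exp (by positivity)))
    | succ n ih =>
      intro t ht
      have e1 : U (n + 1 + 1) t - U (n + 1) t = Φ (U (n + 1)) t - Φ (U n) t := by
        rw [← hU1, ← hU1]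
      rw [e1, hΦ]
      simp only [add_sub_add_left_eq_sub]
      refine (norm_volterra_sub_le hT hT1 hb hbκ hκ.le
        (g := fun s => M R * (1 / 2) ^ n * Real.exp (2 * κ * s))
        (hUc (n + 1)) (hUc n) t (by fun_prop) (fun s hs => ih s (hs.trans ht))).trans ?_
      rw [intervalIntegral.integral_const_mul]
      have h1 := mul_integral_exp_le hκ t
      have h2 : 0 ≤ M R * (1 / 2) ^ n := mul_nonneg (hM0 R) (by positivity)
      calc _ = M R * (1 / 2) ^ n * (κ * ∫ s in (0 : ℝ)..t, Real.exp (2 * κ * s)) := by ring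
        _ ≤ M R * (1 / 2) ^ n * (Real.exp (2 * κ * t) / 2) := by gcongr
        _ = _ := by rw [pow_succ]; ring
  set c : ℝ≥0 → ℕ → ℝ := fun R N => 2 * M R * Real.exp (2 * κ * R) * (1 / 2) ^ N with hc
  have hc0 : ∀ R, Tendsto (c R) atTop (𝓝 0) := fun R => by
    simpa [hc] using (tendsto_pow_atTop_nhds_zero_of_lt_one (by norm_num : (0 : ℝ) ≤ 1 / 2)
      (by norm_num)).const_mul (2 * M R * Real.exp (2 * κ * R))
  obtain ⟨u, hu, hdist⟩ := exists_continuous_limit hUc hc0 (by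
    intro R t ht N n hNn
    have hle : dist (U N t) (U n t) ≤ c R N - c R n := by
      induction n, hNn using Nat.le_induction with
      | base => simp
      | succ n hn ih =>
        have h1 := hstep R n t ht
        have h2 : M R * (1 / 2) ^ n * Real.exp (2 * κ * t) ≤ c R n - c R (n + 1) := by
          have h3 : Real.exp (2 * κ * t) ≤ Real.exp (2 * κ * R) := by gcongr
          have h4 : 0 ≤ M R * (1 / 2) ^ n := mul_nonneg (hM0 R) (by positivity)
          calc _ ≤ M R * (1 / 2) ^ n * Real.exp (2 * κ * R) := by gcongr
            _ = _ := by simp only [hc, pow_succ]; ring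
        have h5 := dist_triangle (U N t) (U n t) (U (n + 1) t)
        rw [dist_comm (U n t), dist_eq_norm (U (n + 1) t)] at h5
        linarith
    have h6 : 0 ≤ c R n := by have := hM0 R; positivity
    linarith)
  have hlim : ∀ t, Tendsto (fun n => U n t) atTop (𝓝 (u t)) := fun t =>
    tendsto_iff_dist_tendsto_zero.2
      (squeeze_zero (fun _ => dist_nonneg) (hdist t t le_rfl) (hc0 t))
  refine ⟨u, hu, fun t => (h𝒦 t).mem_of_tendsto (hlim t) (Eventually.of_forall fun n => hU𝒦 n t),
    fun t => ?_⟩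
  have h1 : Tendsto (fun n => U (n + 1) t) atTop (𝓝 (Φ u t)) := by
    refine tendsto_iff_norm_sub_tendsto_zero.2 (squeeze_zero (fun _ => norm_nonneg _)
      (g := fun n => κ * (t * c t n)) (fun n => ?_) ?_)
    · rw [hU1, hΦ]
      simp only [add_sub_add_left_eq_sub]
      refine (norm_volterra_sub_le hT hT1 hb hbκ hκ.le (g := fun _ => c t n) (hUc n) hu t
        continuous_const (fun s hs => ?_)).trans_eq ?_
      · rw [← dist_eq_norm]; exact hdist t s hs n
      · simp
    · simpa using ((hc0 t).const_mul (t : ℝ)).const_mul κ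
  exact tendsto_nhds_unique ((tendsto_add_atTop_iff_nat 1).2 (hlim t)) h1

end Volterra

/-! ### Predictable versions of continuous adapted curves in `L^q` -/

section Predictable

variable {Ω : Type*} [mΩ : MeasurableSpace Ω] {P : Measure Ω} {𝓕 : Filtration ℝ≥0 mΩ}
  {H : Type*} [NormedAddCommGroup H] [MeasurableSpace H] [BorelSpace H]
  [SecondCountableTopology H]

/-- The left grid point of mesh `1/N` used at time `t`: the largest `j/N < t`, or `0`. -/
noncomputable def leftGrid (N : ℕ) (t : ℝ≥0) : ℝ≥0 := ((⌈t * N⌉₊ - 1 : ℕ) : ℝ≥0) / N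

lemma leftGrid_le {N : ℕ} (hN : 0 < N) (t : ℝ≥0) : leftGrid N t ≤ t := by
  have hN' : (0 : ℝ≥0) < N := by exact_mod_cast hN
  rw [leftGrid, div_le_iff₀ hN']
  rcases Nat.eq_zero_or_pos ⌈t * N⌉₊ with h | h
  · rw [h]; simp
  · exact (Nat.lt_ceil.1 (Nat.sub_lt h one_pos)).le

lemma dist_leftGrid_le {N : ℕ} (hN : 0 < N) (t : ℝ≥0) : dist (leftGrid N t) t ≤ 1 / N := by
  have hN' : (0 : ℝ) < N := by exact_mod_cast hN
  have h1 : (leftGrid N t : ℝ) ≤ t := NNReal.coe_le_coe.2 (leftGrid_le hN t)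
  rw [dist_comm, NNReal.dist_eq, abs_of_nonneg (by linarith)]
  have h2 : t * N ≤ ((⌈t * N⌉₊ - 1 : ℕ) : ℝ≥0) + 1 := by
    refine (Nat.le_ceil _).trans ?_
    have : ⌈t * N⌉₊ ≤ ⌈t * N⌉₊ - 1 + 1 := by omega
    exact_mod_cast this
  have h3 : (t : ℝ) * N ≤ ((⌈t * N⌉₊ - 1 : ℕ) : ℝ) + 1 := by exact_mod_cast h2
  have h4 : (t : ℝ) ≤ (((⌈t * N⌉₊ - 1 : ℕ) : ℝ) + 1) / N := (le_div_iff₀ hN').2 h3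
  rw [leftGrid, NNReal.coe_div, NNReal.coe_natCast, NNReal.coe_natCast]
  rw [add_div] at h4
  linarith

/-- Freezing an adapted process at the left grid points gives a predictable process. -/
lemma isStronglyPredictable_comp_leftGrid {v : ℝ≥0 → Ω → H}
    (hv : ∀ t, StronglyMeasurable[𝓕 t] (v t))
    {N : ℕ} (hN : 0 < N) : IsStronglyPredictable 𝓕 fun t => v (leftGrid N t) := by
  have hN' : (0 : ℝ≥0) < N := by exact_mod_cast hN
  have hmeas : @Measurable _ _ 𝓕.predictable _ (Function.uncurry fun t => v (leftGrid N t)) := by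
    intro D hD
    have heq : (Function.uncurry fun t => v (leftGrid N t)) ⁻¹' D =
        ⋃ j : ℕ, {t : ℝ≥0 | ⌈t * N⌉₊ - 1 = j} ×ˢ (v ((j : ℝ≥0) / N) ⁻¹' D) := by
      ext ⟨t, ω⟩
      simp [leftGrid]
    rw [heq]
    refine MeasurableSet.iUnion fun j => ?_
    have hD' : MeasurableSet[𝓕 ((j : ℝ≥0) / N)] (v ((j : ℝ≥0) / N) ⁻¹' D) := (hv _).measurable hD
    have hIoc := measurableSet_predictable_Ioc_prod ((j : ℝ≥0) / N) (((j : ℝ≥0) + 1) / N) hD'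
    rcases Nat.eq_zero_or_pos j with rfl | hj
    · have hset : {t : ℝ≥0 | ⌈t * N⌉₊ - 1 = 0} = {⊥} ∪ Ioc ((0 : ℕ) / (N : ℝ≥0))
        (((0 : ℕ) + 1) / N) := by
        ext t
        have h1 : ⌈t * N⌉₊ - 1 = 0 ↔ t ≤ 1 / N := by
          rw [Nat.sub_eq_zero_iff_le, Nat.ceil_le, le_div_iff₀ hN', Nat.cast_one]
        simp only [mem_ofPred_eq, h1, bot_eq_zero, Nat.cast_zero, zero_div, zero_add,
          singleton_union, mem_insert_iff, mem_Ioc]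
        constructor
        · intro h
          rcases eq_or_ne t 0 with h0 | h0
          · exact Or.inl h0
          · exact Or.inr ⟨pos_iff_ne_zero.2 h0, h⟩
        · rintro (h | h)
          · rw [h]; exact zero_le
          · exact h.2
      rw [hset, union_prod]
      refine MeasurableSet.union ?_ hIoc
      have h0 : ((0 : ℕ) : ℝ≥0) / N = ⊥ := by simp
      rw [h0] at hD' ⊢
      exact measurableSet_predictable_singleton_bot_prod hD'
    · have hset : {t : ℝ≥0 | ⌈t * N⌉₊ - 1 = j} = Ioc ((j : ℝ≥0) / N) (((j : ℝ≥0) + 1) / N) := by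
        ext t
        have h1 : ⌈t * N⌉₊ - 1 = j ↔ ⌈t * N⌉₊ = j + 1 := by omega
        rw [mem_ofPred_eq, h1, Nat.ceil_eq_iff (by omega), mem_Ioc, div_lt_iff₀ hN',
          le_div_iff₀ hN']
        simp
      rw [hset]
      exact hIoc
  exact hmeas.stronglyMeasurable

variable [IsProbabilityMeasure P] [CompleteSpace H] {q : ℝ≥0∞} [Fact (1 ≤ q)]

/-- A continuous adapted curve in `L^q` has a predictable version: freeze it along grids so fine
that the approximations converge almost surely at every fixed time. No completeness of the
filtration is needed. -/
theorem exists_predictable_version {u : ℝ≥0 → Lp H q P} (hu : Continuous u)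
    (had : ∀ t, AEStronglyMeasurable[𝓕 t] (u t) P) :
    ∃ X : ℝ≥0 → Ω → H, IsStronglyPredictable 𝓕 X ∧ ∀ t, X t =ᵐ[P] u t := by
  have hq1 : 1 ≤ q := Fact.out
  have hq0 : q ≠ 0 := (zero_lt_one.trans_le hq1).ne'
  choose v hv hvu using fun t => had t
  have hgrid : ∀ n : ℕ, ∃ N : ℕ, 0 < N ∧ ∀ t ≤ (n : ℝ≥0), dist (u (leftGrid N t)) (u t) < (1 / 2)
      ^ n := by
    intro n
    have huc := (isCompact_Icc (a := (0 : ℝ≥0)) (b := n)).uniformContinuousOn_of_continuous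
      hu.continuousOn
    obtain ⟨δ, hδ, h⟩ := Metric.uniformContinuousOn_iff.1 huc ((1 / 2) ^ n) (by positivity)
    obtain ⟨N, hN⟩ := exists_nat_one_div_lt hδ
    refine ⟨N + 1, N.succ_pos, fun t ht => h _ ⟨zero_le, (leftGrid_le N.succ_pos t).trans ht⟩ t
      ⟨zero_le, ht⟩ ((dist_leftGrid_le N.succ_pos t).trans_lt ?_)⟩
    exact_mod_cast hN
  choose N hN0 hN using hgrid
  set Y : ℕ → ℝ≥0 → Ω → H := fun n t => v (leftGrid (N n) t) with hY
  -- where the limit does not exist, which for each `t` is a null set, `limUnder` is irrelevant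
  refine ⟨fun t ω => limUnder atTop fun n => Y n t ω, ?_, fun t => ?_⟩
  · have := fun n => isStronglyPredictable_comp_leftGrid hv (hN0 n)
    exact @StronglyMeasurable.limUnder ℕ (ℝ≥0 × Ω) H 𝓕.predictable _ _ atTop _
      (fun n => Function.uncurry (Y n)) _ _ this
  · have hdist : ∀ n : ℕ, t ≤ n → eLpNorm (Y n t - (u t : Ω → H)) q P < ENNReal.ofReal
      ((1 / 2) ^ n) := by
      intro n hn
      have h1 := hN n t hn
      rw [← ENNReal.ofReal_lt_ofReal_iff (by positivity), Lp.dist_def,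
        ENNReal.ofReal_toReal (by
          rw [← eLpNorm_congr_ae (Lp.coeFn_sub _ _)]; exact Lp.eLpNorm_ne_top _)] at h1
      refine lt_of_eq_of_lt (eLpNorm_congr_ae ?_) h1
      exact (hvu _).symm.sub (ae_eq_refl _)
    obtain ⟨n₀, hn₀⟩ := exists_nat_ge t
    have hYm : ∀ n, AEStronglyMeasurable (Y n t) P := fun n =>
      ((hv _).mono (𝓕.le _)).aestronglyMeasurable
    have hconv : ∀ᵐ ω ∂P, ∃ l, Tendsto (fun n => Y (n + n₀) t ω) atTop (𝓝 l) := by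
      refine Lp.ae_tendsto_of_cauchy_eLpNorm (fun n => hYm _) hq1
        (B := fun n => ENNReal.ofReal (2 * (1 / 2) ^ n)) ?_ ?_
      · have hs : Summable fun n : ℕ => 2 * (1 / 2 : ℝ) ^ n :=
          (summable_geometric_of_lt_one (by norm_num) (by norm_num)).mul_left 2
        exact hs.tsum_ofReal_ne_top
      · intro M n k hn hk
        have hle : ∀ j, M ≤ j → eLpNorm (Y (j + n₀) t - (u t : Ω → H)) q P < ENNReal.ofReal
            ((1 / 2) ^ M) := by
          intro j hj
          refine (hdist (j + n₀) (hn₀.trans (by exact_mod_cast Nat.le_add_left _ _))).trans_le ?_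
          refine ENNReal.ofReal_le_ofReal (pow_le_pow_of_le_one (by norm_num) (by norm_num)
              (by omega))
        have h1 : Y (n + n₀) t - Y (k + n₀) t = (Y (n + n₀) t - (u t : Ω → H)) -
            (Y (k + n₀) t - (u t : Ω → H)) := by
          abel
        rw [h1]
        refine (eLpNorm_sub_le ((hYm _).sub (Lp.aestronglyMeasurable _))
          ((hYm _).sub (Lp.aestronglyMeasurable _)) hq1).trans_lt ?_
        rw [two_mul, ENNReal.ofReal_add (by positivity) (by positivity)]
        exact ENNReal.add_lt_add (hle n hn) (hle k hk)
    -- the almost sure limit is `u t`, being also the limit in probability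
    have hmeas : TendstoInMeasure P (fun n => Y (n + n₀) t) atTop (u t) := by
      refine tendstoInMeasure_of_tendsto_eLpNorm hq0 (fun n => hYm _) (Lp.aestronglyMeasurable _) ?_
      have h0 : Tendsto (fun n : ℕ => ENNReal.ofReal ((1 / 2) ^ (n + n₀))) atTop (𝓝 0) := by
        have := (tendsto_pow_atTop_nhds_zero_of_lt_one (by norm_num : (0 : ℝ) ≤ 1 / 2)
          (by norm_num)).comp (tendsto_add_atTop_nat n₀)
        have h2 := (ENNReal.continuous_ofReal.tendsto 0).comp this
        rw [ENNReal.ofReal_zero] at h2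
        exact h2
      refine tendsto_of_tendsto_of_tendsto_of_le_of_le tendsto_const_nhds h0 (fun _ => zero_le)
        fun n => (hdist _ (hn₀.trans (by exact_mod_cast Nat.le_add_left _ _))).le
    have hlim : ∀ᵐ ω ∂P, Tendsto (fun n => Y (n + n₀) t ω) atTop
        (𝓝 (limUnder atTop fun n => Y n t ω)) := by
      filter_upwards [hconv] with ω ⟨l, hl⟩
      have hl' := (tendsto_add_atTop_iff_nat n₀ (f := fun n => Y n t ω)).1 hl
      rwa [hl'.limUnder_eq]
    exact tendstoInMeasure_ae_unique (tendstoInMeasure_of_tendsto_ae (fun n => hYm _) hlim) hmeas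

end Predictable

/-! ### Bochner integrals in `L^q` and integrals of paths -/

section Bochner

variable {Ω : Type*} [mΩ : MeasurableSpace Ω] {P : Measure Ω} [IsProbabilityMeasure P]
  {H : Type*} [NormedAddCommGroup H] [NormedSpace ℝ H] {q : ℝ≥0∞} [Fact (1 ≤ q)]

omit [NormedSpace ℝ H] in
lemma integral_norm_le_norm_lp (f : Lp H q P) : ∫ ω, ‖f ω‖ ∂P ≤ ‖f‖ := by
  rw [integral_norm_eq_lintegral_enorm (Lp.aestronglyMeasurable f), Lp.norm_def,
    ← eLpNorm_one_eq_lintegral_enorm]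
  exact ENNReal.toReal_mono (Lp.eLpNorm_ne_top f)
    (eLpNorm_le_eLpNorm_of_exponent_le Fact.out (Lp.aestronglyMeasurable f))

omit [NormedSpace ℝ H] in
lemma integrable_lp (f : Lp H q P) : Integrable f P := (Lp.memLp f).integrable Fact.out

variable {𝕋 : Type*} [MeasurableSpace 𝕋] {μ : Measure 𝕋} [SFinite μ]

omit [NormedSpace ℝ H] [SFinite μ] in
lemma integrable_prod_of_lp {φ : 𝕋 → Lp H q P} {F : 𝕋 → Ω → H} (hφ : Integrable φ μ)
    (hF : AEStronglyMeasurable (Function.uncurry F) (μ.prod P))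
    (h : ∀ᵐ s ∂μ, φ s =ᵐ[P] F s) : Integrable (Function.uncurry F) (μ.prod P) := by
  rw [integrable_prod_iff hF]
  refine ⟨?_, hφ.norm.mono' hF.norm.integral_prod_right' ?_⟩
  · filter_upwards [h] with s hs
    exact (integrable_lp (φ s)).congr hs
  · filter_upwards [h] with s hs
    rw [Real.norm_of_nonneg (integral_nonneg fun _ => norm_nonneg _)]
    refine le_trans (le_of_eq (integral_congr_ae ?_)) (integral_norm_le_norm_lp (φ s))
    filter_upwards [hs] with ω hω
    rw [hω]; rfl

/-- The Bochner integral of an `L^q`-valued function is given by the integrals of the paths of a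
jointly measurable version. Both sides have the same integrals over measurable sets. -/
lemma coeFn_integral_lp [CompleteSpace H] {φ : 𝕋 → Lp H q P} {F : 𝕋 → Ω → H} (hφ : Integrable φ μ)
    (hF : AEStronglyMeasurable (Function.uncurry F) (μ.prod P))
    (h : ∀ᵐ s ∂μ, φ s =ᵐ[P] F s) :
    (∫ s, φ s ∂μ : Lp H q P) =ᵐ[P] fun ω => ∫ s, F s ω ∂μ := by
  have hint := integrable_prod_of_lp hφ hF h
  refine Integrable.ae_eq_of_forall_setIntegral_eq _ _ (integrable_lp _) hint.integral_prod_right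
    fun D hD _ => ?_
  -- integration over `D` is a continuous linear map, hence commutes with the Bochner integral
  let Λ : Lp H q P →L[ℝ] H := LinearMap.mkContinuous
    { toFun := fun f => ∫ ω in D, f ω ∂P
      map_add' := fun f g => by
        rw [← integral_add (integrable_lp f).integrableOn (integrable_lp g).integrableOn]
        exact integral_congr_ae (ae_restrict_of_ae (Lp.coeFn_add f g))
      map_smul' := fun c f => by
        rw [RingHom.id_apply, ← integral_smul]
        exact integral_congr_ae (ae_restrict_of_ae (Lp.coeFn_smul c f)) } 1 (fun f => by
      rw [one_mul]
      refine (norm_integral_le_integral_norm _).trans ((setIntegral_le_integral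
        (integrable_lp f).norm (ae_of_all _ fun _ => norm_nonneg _)).trans
        (integral_norm_le_norm_lp f)))
  have h1 : ∫ ω in D, (∫ s, φ s ∂μ : Lp H q P) ω ∂P = ∫ s, (∫ ω in D, φ s ω ∂P) ∂μ :=
    (ContinuousLinearMap.integral_comp_comm Λ hφ).symm
  have h2 : ∫ s, (∫ ω in D, φ s ω ∂P) ∂μ = ∫ s, (∫ ω in D, F s ω ∂P) ∂μ := by
    refine integral_congr_ae ?_
    filter_upwards [h] with s hs
    exact integral_congr_ae (ae_restrict_of_ae hs)
  rw [h1, h2]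
  refine integral_integral_swap (f := F) (hint.mono_measure ?_)
  exact Measure.prod_mono le_rfl Measure.restrict_le_self

end Bochner

/-! ### Minkowski's integral inequality -/

section Minkowski

/-- **Minkowski's integral inequality** over a probability space: the `L^p` norm of an integral is
at most the integral of the `L^p` norms. -/
theorem lintegral_lintegral_rpow_le {Ω 𝕋 : Type*} [MeasurableSpace Ω] [MeasurableSpace 𝕋]
    {P : Measure Ω} [IsProbabilityMeasure P] {μ : Measure 𝕋} [SFinite μ] {F : 𝕋 → Ω → ℝ≥0∞}
    (hF : Measurable (Function.uncurry F)) {p : ℝ} (hp : 1 ≤ p) :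
    (∫⁻ ω, (∫⁻ s, F s ω ∂μ) ^ p ∂P) ^ (1 / p) ≤ ∫⁻ s, (∫⁻ ω, F s ω ^ p ∂P) ^ (1 / p) ∂μ := by
  rcases hp.eq_or_lt with rfl | hp1
  · simp only [ENNReal.rpow_one, div_one]
    rw [lintegral_lintegral_swap]
    exact (hF.comp measurable_swap).aemeasurable
  have hp0 : 0 < p := zero_lt_one.trans hp1
  have hpq : p.HolderConjugate (p.conjExponent) := Real.HolderConjugate.conjExponent hp1
  set q := p.conjExponent
  set g : Ω → ℝ≥0∞ := fun ω => ∫⁻ s, F s ω ∂μ with hg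
  have hgm : Measurable g := hF.lintegral_prod_left'
  set N := ∫⁻ s, (∫⁻ ω, F s ω ^ p ∂P) ^ (1 / p) ∂μ with hN
  -- truncation makes the `p`-th moment finite, so that it may be cancelled below
  set G : ℕ → Ω → ℝ≥0∞ := fun n ω => min (g ω) n with hG
  have hGm : ∀ n, Measurable (G n) := fun n => hgm.min measurable_const
  have hGN : ∀ n, ∫⁻ ω, G n ω ^ p ∂P ≤ N ^ p := by
    intro n
    set a := ∫⁻ ω, G n ω ^ p ∂P with ha
    have hatop : a ≠ ∞ := by
      have h1 : a ≤ ∫⁻ _, (n : ℝ≥0∞) ^ p ∂P :=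
        lintegral_mono fun ω => ENNReal.rpow_le_rpow (min_le_right _ _) hp0.le
      refine ne_top_of_le_ne_top ?_ h1
      rw [lintegral_const, measure_univ, mul_one]
      finiteness
    have hle : a ≤ N * a ^ (1 / q) := by
      calc a ≤ ∫⁻ ω, (∫⁻ s, F s ω ∂μ) * G n ω ^ (p - 1) ∂P := by
            refine lintegral_mono fun ω => ?_
            have h1 : G n ω ^ p = G n ω * G n ω ^ (p - 1) := by
              conv_lhs => rw [show p = 1 + (p - 1) by ring,
                ENNReal.rpow_add_of_nonneg _ _ zero_le_one (by linarith), ENNReal.rpow_one]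
            rw [h1]
            exact mul_le_mul_left (min_le_left _ _) _
        _ = ∫⁻ ω, ∫⁻ s, F s ω * G n ω ^ (p - 1) ∂μ ∂P := by
            refine lintegral_congr fun ω => ?_
            have : Measurable fun s => F s ω := hF.comp measurable_prodMk_right
            rw [lintegral_mul_const _ this]
        _ = ∫⁻ s, ∫⁻ ω, F s ω * G n ω ^ (p - 1) ∂P ∂μ := by
            rw [lintegral_lintegral_swap]
            exact ((hF.comp measurable_swap).mul
              (((hGm n).comp measurable_fst).pow_const _)).aemeasurable
        _ ≤ ∫⁻ s, (∫⁻ ω, F s ω ^ p ∂P) ^ (1 / p) * a ^ (1 / q) ∂μ := by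
            refine lintegral_mono fun s => ?_
            refine (ENNReal.lintegral_mul_le_Lp_mul_Lq P hpq
              (hF.comp measurable_prodMk_left).aemeasurable
              ((hGm n).pow_const (p - 1)).aemeasurable).trans_eq ?_
            congr 2
            refine lintegral_congr fun ω => ?_
            rw [← ENNReal.rpow_mul]
            congr 1
            exact hpq.sub_one_mul_conj
        _ = N * a ^ (1 / q) := by
            rw [lintegral_mul_const' _ _ (ENNReal.rpow_ne_top_of_nonneg
              (one_div_nonneg.2 hpq.symm.nonneg) hatop)]
    rcases eq_or_ne a 0 with h0 | h0
    · rw [h0]; exact zero_le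
    -- cancel `a ^ (1 / q)`, using `1 / p + 1 / q = 1`
    have h2 : a ^ (1 / p) * a ^ (1 / q) ≤ N * a ^ (1 / q) := by
      rw [← ENNReal.rpow_add _ _ h0 hatop, one_div, one_div, hpq.inv_add_inv_eq_one,
        ENNReal.rpow_one, ← one_div]
      exact hle
    have h3 : a ^ (1 / p) ≤ N := by
      refine (ENNReal.mul_le_mul_iff_left ?_ ?_).1 h2
      · simp [h0, hatop]
      · exact ENNReal.rpow_ne_top_of_nonneg (one_div_nonneg.2 hpq.symm.nonneg) hatop
    calc a = (a ^ (1 / p)) ^ p := by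
          rw [← ENNReal.rpow_mul, one_div_mul_cancel hp0.ne', ENNReal.rpow_one]
      _ ≤ N ^ p := ENNReal.rpow_le_rpow h3 hp0.le
  have hlim : ∫⁻ ω, g ω ^ p ∂P ≤ N ^ p := by
    have h1 : ∀ ω, Tendsto (fun n => G n ω ^ p) atTop (𝓝 (g ω ^ p)) := by
      intro ω
      have h2 : Tendsto (fun n : ℕ => min (g ω) (n : ℝ≥0∞)) atTop (𝓝 (min (g ω) ∞)) :=
        tendsto_const_nhds.min ENNReal.tendsto_nat_nhds_top
      rw [min_eq_left le_top] at h2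
      exact ((ENNReal.continuous_rpow_const (y := p)).tendsto _).comp h2
    calc ∫⁻ ω, g ω ^ p ∂P = ∫⁻ ω, liminf (fun n => G n ω ^ p) atTop ∂P :=
          lintegral_congr fun ω => (h1 ω).liminf_eq.symm
      _ ≤ liminf (fun n => ∫⁻ ω, G n ω ^ p ∂P) atTop :=
          lintegral_liminf_le fun n => (hGm n).pow_const p
      _ ≤ N ^ p := liminf_le_of_le (by isBoundedDefault) fun b hb => by
          obtain ⟨n, hn⟩ := hb.exists
          exact hn.trans (hGN n)
  calc _ ≤ (N ^ p) ^ (1 / p) := ENNReal.rpow_le_rpow hlim (by positivity)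
    _ = N := by rw [← ENNReal.rpow_mul, mul_one_div_cancel hp0.ne', ENNReal.rpow_one]

end Minkowski

/-! ### Existence of mild solutions with moments of order `m` -/

section Solutions

variable {Ω H : Type*} [mΩ : MeasurableSpace Ω] [NormedAddCommGroup H] [InnerProductSpace ℝ H]

lemma secondCountableTopology_of_hilbertBasis (e : HilbertBasis ℕ ℝ H) :
    SecondCountableTopology H := by
  have h1 : TopologicalSpace.IsSeparable (Set.range e) := (countable_range e).isSeparable
  have h2 : TopologicalSpace.IsSeparable
      (closure (Submodule.span ℝ (Set.range e) : Set H)) := h1.span.closure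
  rw [← Submodule.topologicalClosure_coe, e.dense_span, Submodule.top_coe,
    TopologicalSpace.isSeparable_univ_iff] at h2
  exact UniformSpace.secondCountable_of_separable H

omit [InnerProductSpace ℝ H] in
lemma stronglyMeasurable_uncurry_of_predictable {𝓕 : Filtration ℝ≥0 mΩ} {X : ℝ≥0 → Ω → H}
    (hX : IsStronglyPredictable 𝓕 X) : StronglyMeasurable (Function.uncurry X) := by
  refine StronglyMeasurable.mono hX (measurableSpace_le_predictable_of_measurableSet ?_ ?_)
  · exact fun D hD => (measurableSet_singleton _).prod (𝓕.le _ _ hD)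
  · exact fun t D hD => measurableSet_Ioi.prod (𝓕.le _ _ hD)

variable {P : Measure Ω} {m : ℝ}

lemma norm_compLpL_apply_le {S : H →L[ℝ] H} (hS : ∀ x, ‖S x‖ ≤ ‖x‖) [Fact (1 ≤ ENNReal.ofReal m)]
    (f : Lp H (ENNReal.ofReal m) P) : ‖S.compLpL (ENNReal.ofReal m) P f‖ ≤ ‖f‖ := by
  refine Lp.norm_le_norm_of_ae_le ?_
  filter_upwards [S.coeFn_compLpL f] with ω hω
  rw [hω]
  exact hS _

omit [InnerProductSpace ℝ H] in
lemma memLp_of_lintegral_rpow_lt_top {X : Ω → H} (hm : 0 < m) (hX : AEStronglyMeasurable X P)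
    (h : ∫⁻ ω, ‖X ω‖ₑ ^ m ∂P < ∞) : MemLp X (ENNReal.ofReal m) P :=
  ⟨hX, by rw [eLpNorm_ofReal_eq hm]; finiteness⟩

variable [MeasurableSpace H] [BorelSpace H] [IsProbabilityMeasure P] {p : ℝ} {C : ℝ≥0}
  {B : H → FiniteMomentMeasure H p → H} [Fact (1 ≤ ENNReal.ofReal m)]

omit [InnerProductSpace ℝ H] in
/-- Along a continuous curve in `L^m(Ω; H)` the drift depends jointly continuously on time and
space. -/
lemma continuous_drift_lpLaw [SecondCountableTopology H] (hp : 0 < p) (hpm : p ≤ m)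
    (hB : ∀ x y μ ν, ‖B x μ - B y ν‖ₑ ≤ C * (‖x - y‖ₑ + wasserstein μ ν))
    {u : ℝ≥0 → Lp H (ENNReal.ofReal m) P} (hu : Continuous u) :
    Continuous fun z : ℝ≥0 × H => B z.2 (lpLaw hp hpm (u z.1)) := by
  refine continuous_iff_continuousAt.2 fun z => ?_
  rw [ContinuousAt, tendsto_iff_edist_tendsto_0]
  have h1 : Continuous fun y : ℝ≥0 × H =>
      (C : ℝ≥0∞) * (‖y.2 - z.2‖ₑ + ENNReal.ofReal ‖u y.1 - u z.1‖) := by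
    have h2 : Continuous fun y : ℝ≥0 × H => u y.1 - u z.1 := by fun_prop
    refine ENNReal.continuous_const_mul ENNReal.coe_ne_top |>.comp ?_
    exact (by fun_prop : Continuous fun y : ℝ≥0 × H => y.2 - z.2).enorm.add
      (ENNReal.continuous_ofReal.comp h2.norm)
  have h3 := h1.tendsto z
  simp only [sub_self, enorm_zero, norm_zero, ENNReal.ofReal_zero, add_zero, mul_zero] at h3
  refine tendsto_of_tendsto_of_tendsto_of_le_of_le tendsto_const_nhds h3 (fun _ => zero_le)
    fun y => ?_
  rw [edist_eq_enorm_sub]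
  refine (hB _ _ _ _).trans ?_
  gcongr
  exact wasserstein_lpLaw_le hp hpm _ _

variable {𝓕 : Filtration ℝ≥0 mΩ} {e : HilbertBasis ℕ ℝ H} {lam β : ℕ → ℝ} {L : ℕ → ℝ≥0 → Ω → ℝ}
  {S : ℝ≥0 → H →L[ℝ] H} [CompleteSpace H]

/-- A predictable version of a continuous adapted solution of the equation in `L^m(Ω; H)` is a mild
solution. -/
lemma isMildSolution_of_lp [SecondCountableTopology H] (hp : 0 < p) (hpm : p ≤ m)
    (hB : ∀ x y μ ν, ‖B x μ - B y ν‖ₑ ≤ C * (‖x - y‖ₑ + wasserstein μ ν))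
    (hS : ∀ x, Continuous fun t => S t x) (hS1 : ∀ t x, ‖S t x‖ ≤ ‖x‖)
    {w : ℝ≥0 → Lp H (ENNReal.ofReal m) P} (hwZ : ∀ t, IsStochConvolution P e lam β L t (w t))
    {ξ : Ω → H} (hξ : MemLp ξ (ENNReal.ofReal m) P) {u : ℝ≥0 → Lp H (ENNReal.ofReal m) P}
    (hu : Continuous u)
    (hueq : ∀ t, u t = ((S t).compLpL (ENNReal.ofReal m) P hξ.toLp + w t) + ∫ s in (0 : ℝ)..t,
      (S (t - s.toNNReal)).compLpL (ENNReal.ofReal m) P (lpDrift hp hpm hB (u s.toNNReal)))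
    {X : ℝ≥0 → Ω → H} (hX : IsStronglyPredictable 𝓕 X) (hXu : ∀ t, X t =ᵐ[P] u t) :
    IsMildSolution P 𝓕 p e lam β L S B ξ X := by
  have hXm : StronglyMeasurable (Function.uncurry X) := stronglyMeasurable_uncurry_of_predictable hX
  have hae : ∀ t, AEMeasurable (X t) P := fun t => (aemeasurable_lp (u t)).congr (hXu t).symm
  have hmo : ∀ t, ∫⁻ ω, ‖X t ω‖ₑ ^ p ∂P < ∞ := fun t =>
    moment_lt_top_of_memLp hp hpm ((Lp.memLp (u t)).ae_eq (hXu t).symm)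
  -- the laws of `X` form a continuous curve, which makes the integrand `F` jointly measurable
  have hlaw : ∀ t, lawOf (X t) (hae t) (hmo t) = lpLaw hp hpm (u t) := fun t =>
    lawOf_congr _ _ _ _ (hXu t)
  set F : ℝ≥0 → ℝ → Ω → H := fun t s ω =>
    S (t - s.toNNReal) (B (X s.toNNReal ω) (lpLaw hp hpm (u s.toNNReal))) with hF
  set φ : ℝ≥0 → ℝ → Lp H (ENNReal.ofReal m) P := fun t s =>
    (S (t - s.toNNReal)).compLpL (ENNReal.ofReal m) P (lpDrift hp hpm hB (u s.toNNReal)) with hφ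
  have hFm : ∀ t, StronglyMeasurable (Function.uncurry (F t)) := by
    intro t
    have hc1 := continuous_drift_lpLaw hp hpm hB hu
    have hc2 : Continuous fun z : ℝ × H => (t - z.1.toNNReal, B z.2
        (lpLaw hp hpm (u z.1.toNNReal))) :=
      (by fun_prop : Continuous fun z : ℝ × H => t - z.1.toNNReal).prodMk
        (hc1.comp (by fun_prop : Continuous fun z : ℝ × H => (z.1.toNNReal, z.2)))
    have hc3 := (continuous_uncurry_of_contraction hS hS1).comp hc2
    have hm1 : StronglyMeasurable fun z : ℝ × Ω => X z.1.toNNReal z.2 :=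
      hXm.comp_measurable ((measurable_real_toNNReal.comp measurable_fst).prodMk measurable_snd)
    exact hc3.comp_stronglyMeasurable (measurable_fst.stronglyMeasurable.prodMk hm1)
  have hφF : ∀ t s, φ t s =ᵐ[P] F t s := by
    intro t s
    filter_upwards [(S (t - s.toNNReal)).coeFn_compLpL (lpDrift hp hpm hB (u s.toNNReal)),
      coeFn_lpDrift hp hpm hB (u s.toNNReal), hXu s.toNNReal] with ω h1 h2 h3
    rw [hφ, hF]
    simp only
    rw [h1, h2, h3]
  have hb : Continuous (lpDrift (P := P) hp hpm hB) := by
    refine (LipschitzWith.of_dist_le_mul (K := 2 * C) fun U V => ?_).continuous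
    rw [dist_eq_norm, dist_eq_norm]
    exact norm_lpDrift_sub_le hp hpm hB U V
  have hφi : ∀ t : ℝ≥0, Integrable (φ t) (volume.restrict (Ioc (0 : ℝ) t)) := by
    intro t
    have h1 := intervalIntegrable_volterra (T := fun t => (S t).compLpL (ENNReal.ofReal m) P)
      (continuous_uncurry_of_contraction (continuous_compLpL hS hS1)
        fun t => norm_compLpL_apply_le (hS1 t)) hb hu t
    exact (intervalIntegrable_iff_integrableOn_Ioc_of_le t.coe_nonneg).1 h1
  have hint : ∀ t : ℝ≥0, ∀ᵐ ω ∂P, IntervalIntegrable (fun s => F t s ω) volume 0 t := by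
    intro t
    filter_upwards [(integrable_prod_of_lp (hφi t) (hFm t).aestronglyMeasurable
      (ae_of_all _ (hφF t))).prod_left_ae] with ω hω
    exact (intervalIntegrable_iff_integrableOn_Ioc_of_le t.coe_nonneg).2 hω
  refine ⟨hX, hX.stronglyAdapted, hae, hmo, fun t => ?_, fun t => ⟨w t, hwZ t, ?_⟩⟩
  · simp only [hlaw]
    exact hint t
  · simp only [hlaw]
    have h1 := coeFn_integral_lp (hφi t) (hFm t).aestronglyMeasurable (ae_of_all _ (hφF t))
    have h2 := hueq t
    rw [intervalIntegral.integral_of_le t.coe_nonneg] at h2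
    filter_upwards [hXu t, Lp.coeFn_add ((S t).compLpL (ENNReal.ofReal m) P hξ.toLp + w t)
      (∫ s in Ioc (0 : ℝ) t, φ t s), Lp.coeFn_add ((S t).compLpL (ENNReal.ofReal m) P hξ.toLp)
          (w t),
      (S t).coeFn_compLpL hξ.toLp, hξ.coeFn_toLp, h1] with ω h3 h4 h5 h6 h7 h8
    rw [h3, h2, intervalIntegral.integral_of_le t.coe_nonneg]
    rw [h4, Pi.add_apply, h5, Pi.add_apply, h6, h7, h8]
    abel

/-- Existence of a mild solution which is a version of a continuous curve in `L^m(Ω; H)` solving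
the equation there. -/
theorem exists_mildSolution [SecondCountableTopology H] (hp : 0 < p) (hpm : p ≤ m)
    (hB : ∀ x y μ ν, ‖B x μ - B y ν‖ₑ ≤ C * (‖x - y‖ₑ + wasserstein μ ν))
    (hS : ∀ x, Continuous fun t => S t x) (hS1 : ∀ t x, ‖S t x‖ ≤ ‖x‖)
    {w : ℝ≥0 → Lp H (ENNReal.ofReal m) P} (hw : Continuous w)
    (hwad : ∀ t, AEStronglyMeasurable[𝓕 t] (w t) P)
    (hwZ : ∀ t, IsStochConvolution P e lam β L t (w t))
    {ξ : Ω → H} (hξ0 : StronglyMeasurable[𝓕 0] ξ) (hξ : MemLp ξ (ENNReal.ofReal m) P) :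
    ∃ (X : ℝ≥0 → Ω → H) (u : ℝ≥0 → Lp H (ENNReal.ofReal m) P), Continuous u ∧
      (∀ t, X t =ᵐ[P] u t) ∧ IsMildSolution P 𝓕 p e lam β L S B ξ X ∧
      ∀ t, u t = ((S t).compLpL (ENNReal.ofReal m) P hξ.toLp + w t) + ∫ s in (0 : ℝ)..t,
        (S (t - s.toNNReal)).compLpL (ENNReal.ofReal m) P (lpDrift hp hpm hB (u s.toNNReal)) := by
  have hTc := continuous_compLpL (P := P) (m := m) hS hS1
  obtain ⟨u, hu, huad, hueq⟩ := exists_volterra_solution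
    (T := fun t => (S t).compLpL (ENNReal.ofReal m) P) (b := lpDrift hp hpm hB)
    (a := fun t => (S t).compLpL (ENNReal.ofReal m) P hξ.toLp + w t) (κ := 2 * C + 1)
    (continuous_uncurry_of_contraction hTc fun t => norm_compLpL_apply_le (hS1 t))
    (fun t => norm_compLpL_apply_le (hS1 t)) (by positivity)
    (fun U V => (norm_lpDrift_sub_le hp hpm hB U V).trans (by gcongr; linarith))
    ((hTc _).add hw) (fun t => lpMeas H ℝ (𝓕 t) (ENNReal.ofReal m) P)
    (fun t => isClosed_aestronglyMeasurable (𝓕.le t))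
    (fun s t hst f hf => mem_lpMeas_iff_aestronglyMeasurable.2
      ((mem_lpMeas_iff_aestronglyMeasurable.1 hf).mono (𝓕.mono hst)))
    (fun t => Submodule.add_mem _ (mem_lpMeas_iff_aestronglyMeasurable.2 (by
        have h1 : AEStronglyMeasurable[𝓕 t] (fun ω => S t (ξ ω)) P :=
          (S t).continuous.comp_aestronglyMeasurable
            (hξ0.mono (𝓕.mono zero_le)).aestronglyMeasurable
        refine h1.congr ?_
        filter_upwards [(S t).coeFn_compLpL hξ.toLp, hξ.coeFn_toLp] with ω h2 h3
        rw [h2, h3]))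
      (mem_lpMeas_iff_aestronglyMeasurable.2 (hwad t)))
    (fun s t f hf => mem_lpMeas_iff_aestronglyMeasurable.2
      (((S t).continuous.comp_aestronglyMeasurable (mem_lpMeas_iff_aestronglyMeasurable.1 hf)).congr
        ((S t).coeFn_compLpL f).symm))
    (fun t f hf => mem_lpMeas_iff_aestronglyMeasurable.2
      (((lipschitzWith_drift hp hB _).continuous.comp_aestronglyMeasurable
        (mem_lpMeas_iff_aestronglyMeasurable.1 hf)).congr (coeFn_lpDrift hp hpm hB f).symm))
  obtain ⟨X, hX, hXu⟩ := exists_predictable_version hu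
    (fun t => mem_lpMeas_iff_aestronglyMeasurable.1 (huad t))
  exact ⟨X, u, hu, hXu, isMildSolution_of_lp hp hpm hB hS hS1 hwZ hξ hu hueq hX hXu, hueq⟩

omit [InnerProductSpace ℝ H] [CompleteSpace H] [MeasurableSpace H] [BorelSpace H] in
lemma hasIntegrableMoments_of_lp (hp : 0 < p) (hpm : p ≤ m)
    {u : ℝ≥0 → Lp H (ENNReal.ofReal m) P} (hu : Continuous u) {X : ℝ≥0 → Ω → H}
    (hXu : ∀ t, X t =ᵐ[P] u t) : HasIntegrableMoments P p X := by
  intro T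
  have h1 : ∀ t, (∫⁻ ω, ‖X t ω‖ₑ ^ p ∂P) ^ (1 / p) ≤ ‖u t‖ₑ := by
    intro t
    rw [← eLpNorm_ofReal_eq hp, eLpNorm_congr_ae (hXu t), Lp.enorm_def]
    exact eLpNorm_le_eLpNorm_of_exponent_le (ENNReal.ofReal_le_ofReal hpm)
      (Lp.aestronglyMeasurable _)
  have hc : Continuous fun s : ℝ => u s.toNNReal := by fun_prop
  calc _ ≤ ∫⁻ s in Icc (0 : ℝ) T, ‖u s.toNNReal‖ₑ := lintegral_mono fun s => h1 _
    _ < ∞ := (hc.integrableOn_Icc (μ := volume)).2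

omit [CompleteSpace H] in
/-- Grönwall's inequality for the equation in `L^m(Ω; H)`. -/
lemma enorm_lp_solution_le [SecondCountableTopology H] (hp : 0 < p) (hpm : p ≤ m)
    (hB : ∀ x y μ ν, ‖B x μ - B y ν‖ₑ ≤ C * (‖x - y‖ₑ + wasserstein μ ν))
    (hS1 : ∀ t x, ‖S t x‖ ≤ ‖x‖)
    {w : ℝ≥0 → Lp H (ENNReal.ofReal m) P} {M : ℝ} (hM : ∀ t, ‖w t‖ ≤ M)
    {ξ : Ω → H} (hξ : MemLp ξ (ENNReal.ofReal m) P) {u : ℝ≥0 → Lp H (ENNReal.ofReal m) P}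
    (hu : Continuous u)
    (hueq : ∀ t, u t = ((S t).compLpL (ENNReal.ofReal m) P hξ.toLp + w t) + ∫ s in (0 : ℝ)..t,
      (S (t - s.toNNReal)).compLpL (ENNReal.ofReal m) P (lpDrift hp hpm hB (u s.toNNReal)))
    (T : ℝ≥0) : ∀ t ≤ T, ‖u t‖ₑ ≤ 2 * (eLpNorm ξ (ENNReal.ofReal m) P + ENNReal.ofReal M +
        T * ‖lpDrift (P := P) hp hpm hB 0‖ₑ) *
      ENNReal.ofReal (Real.exp (2 * (2 * C + 1) * T)) := by
  set b := lpDrift (P := P) hp hpm hB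
  have hκ : (0 : ℝ) < 2 * C + 1 := by positivity
  have hbb : ∀ U, ‖b U‖ₑ ≤ ‖b 0‖ₑ + ENNReal.ofReal (2 * C + 1) * ‖U‖ₑ := by
    intro U
    have h1 := norm_lpDrift_sub_le hp hpm hB U 0
    rw [sub_zero] at h1
    have h2 : ‖b U‖ ≤ ‖b 0‖ + (2 * C + 1) * ‖U‖ := by
      have h3 := norm_le_norm_add_norm_sub (b 0) (b U)
      rw [norm_sub_rev] at h3
      have h4 := norm_nonneg U
      change ‖b U - b 0‖ ≤ _ at h1
      linarith
    rw [← ofReal_norm, ← ofReal_norm, ← ofReal_norm, ← ENNReal.ofReal_mul hκ.le,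
      ← ENNReal.ofReal_add (norm_nonneg _) (by positivity)]
    exact ENNReal.ofReal_le_ofReal h2
  have hc : Continuous fun s : ℝ => u s.toNNReal := by fun_prop
  intro t ht
  refine (le_of_le_add_mul_lintegral (f := fun t => ‖u t‖ₑ) hκ (T := T)
    (a := eLpNorm ξ (ENNReal.ofReal m) P + ENNReal.ofReal M + T * ‖b 0‖ₑ) ?_ ?_ ?_ t ht).trans ?_
  · have := hξ.2.ne
    finiteness
  · exact (hc.integrableOn_Icc (μ := volume)).2.ne
  · intro t ht
    have h1 : ‖(S t).compLpL (ENNReal.ofReal m) P hξ.toLp‖ₑ ≤ eLpNorm ξ (ENNReal.ofReal m) P := by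
      rw [← Lp.enorm_toLp hξ, enorm_le_iff_norm_le]
      exact norm_compLpL_apply_le (hS1 t) _
    have h2 : ‖w t‖ₑ ≤ ENNReal.ofReal M := by
      rw [← ofReal_norm]; exact ENNReal.ofReal_le_ofReal (hM t)
    have h3 : ‖∫ s in (0 : ℝ)..t, (S (t - s.toNNReal)).compLpL (ENNReal.ofReal m) P
        (b (u s.toNNReal))‖ₑ ≤ T * ‖b 0‖ₑ +
          ENNReal.ofReal (2 * C + 1) * ∫⁻ s in Icc (0 : ℝ) t, ‖u s.toNNReal‖ₑ := by
      rw [intervalIntegral.integral_of_le t.coe_nonneg]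
      calc _ ≤ ∫⁻ s in Ioc (0 : ℝ) t, ‖(S (t - s.toNNReal)).compLpL (ENNReal.ofReal m) P
            (b (u s.toNNReal))‖ₑ := enorm_integral_le_lintegral_enorm _
        _ ≤ ∫⁻ s in Icc (0 : ℝ) t, (‖b 0‖ₑ + ENNReal.ofReal (2 * C + 1) * ‖u s.toNNReal‖ₑ) := by
            refine (lintegral_mono_set Ioc_subset_Icc_self).trans (lintegral_mono fun s => ?_)
            refine le_trans ?_ (hbb _)
            rw [enorm_le_iff_norm_le]
            exact norm_compLpL_apply_le (hS1 _) _
        _ ≤ _ := by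
            rw [lintegral_add_left measurable_const, lintegral_const_mul' _ _ ENNReal.ofReal_ne_top,
              setLIntegral_const, Real.volume_Icc, sub_zero, ENNReal.ofReal_coe_nnreal, mul_comm]
            gcongr
    rw [hueq t]
    calc _ ≤ ‖(S t).compLpL (ENNReal.ofReal m) P hξ.toLp‖ₑ + ‖w t‖ₑ +
          ‖∫ s in (0 : ℝ)..t, (S (t - s.toNNReal)).compLpL (ENNReal.ofReal m) P
            (b (u s.toNNReal))‖ₑ :=
          (enorm_add_le _ _).trans (by gcongr; exact enorm_add_le _ _)
      _ ≤ eLpNorm ξ (ENNReal.ofReal m) P + ENNReal.ofReal M + (T * ‖b 0‖ₑ +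
          ENNReal.ofReal (2 * C + 1) * ∫⁻ s in Icc (0 : ℝ) t, ‖u s.toNNReal‖ₑ) := by gcongr
      _ = _ := by rw [add_assoc, add_assoc, add_assoc]
  · gcongr

end Solutions

/-! ### Uniqueness -/

section Uniqueness

variable {Ω H : Type*} [mΩ : MeasurableSpace Ω] [NormedAddCommGroup H] [InnerProductSpace ℝ H]
  [MeasurableSpace H] [BorelSpace H] [SecondCountableTopology H]
  {P : Measure Ω} [IsProbabilityMeasure P] {p : ℝ} {C : ℝ≥0}
  {B : H → FiniteMomentMeasure H p → H}
  {𝓕 : Filtration ℝ≥0 mΩ} {e : HilbertBasis ℕ ℝ H} {lam β : ℕ → ℝ} {L : ℕ → ℝ≥0 → Ω → ℝ}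
  {S : ℝ≥0 → H →L[ℝ] H} {ξ : Ω → H}

/-- The noise cancels in the difference of two mild solutions, which is therefore controlled
pathwise by the Lipschitz bound on the drift. -/
lemma IsMildSolution.enorm_sub_le
    (hB : ∀ x y μ ν, ‖B x μ - B y ν‖ₑ ≤ C * (‖x - y‖ₑ + wasserstein μ ν))
    (hS1 : ∀ t x, ‖S t x‖ ≤ ‖x‖) {X Y : ℝ≥0 → Ω → H}
    (hX : IsMildSolution P 𝓕 p e lam β L S B ξ X) (hY : IsMildSolution P 𝓕 p e lam β L S B ξ Y)
    (t : ℝ≥0) : ∀ᵐ ω ∂P, ‖X t ω - Y t ω‖ₑ ≤ ∫⁻ s in Icc (0 : ℝ) t,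
      (C * ‖X s.toNNReal ω - Y s.toNNReal ω‖ₑ +
        C * (∫⁻ ω, ‖X s.toNNReal ω - Y s.toNNReal ω‖ₑ ^ p ∂P) ^ (1 / p)) := by
  obtain ⟨Z, hZ, hXeq⟩ := hX.equation t
  obtain ⟨Z', hZ', hYeq⟩ := hY.equation t
  filter_upwards [hXeq, hYeq, hZ.ae_unique hZ', hX.integrable t, hY.integrable t]
    with ω h1 h2 h3 h4 h5
  rw [h1, h2, h3, add_sub_add_right_eq_sub, add_sub_add_left_eq_sub,
    ← intervalIntegral.integral_sub h4 h5, intervalIntegral.integral_of_le t.coe_nonneg]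
  refine (enorm_integral_le_lintegral_enorm _).trans
    ((lintegral_mono_set Ioc_subset_Icc_self).trans (lintegral_mono fun s => ?_))
  rw [← map_sub, ← mul_add]
  calc _ ≤ ‖B (X s.toNNReal ω) (lawOf (X s.toNNReal) (hX.aemeasurable s.toNNReal)
          (hX.moment s.toNNReal)) - B (Y s.toNNReal ω) (lawOf (Y s.toNNReal)
          (hY.aemeasurable s.toNNReal) (hY.moment s.toNNReal))‖ₑ := by
        rw [enorm_le_iff_norm_le]; exact hS1 _ _
    _ ≤ _ := by
        refine (hB _ _ _ _).trans ?_
        gcongr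
        exact wasserstein_lawOf_le _ _ _ _

/-- Uniqueness of mild solutions in the class `𝒦`. -/
theorem IsMildSolution.ae_eq (hp : 1 ≤ p)
    (hB : ∀ x y μ ν, ‖B x μ - B y ν‖ₑ ≤ C * (‖x - y‖ₑ + wasserstein μ ν))
    (hS1 : ∀ t x, ‖S t x‖ ≤ ‖x‖) {X Y : ℝ≥0 → Ω → H}
    (hX : IsMildSolution P 𝓕 p e lam β L S B ξ X) (hY : IsMildSolution P 𝓕 p e lam β L S B ξ Y)
    (hXK : HasIntegrableMoments P p X) (hYK : HasIntegrableMoments P p Y) (t : ℝ≥0) :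
    ∀ᵐ ω ∂P, X t ω = Y t ω := by
  have hp0 : 0 < p := zero_lt_one.trans_le hp
  have hXm := (stronglyMeasurable_uncurry_of_predictable hX.predictable).measurable
  have hYm := (stronglyMeasurable_uncurry_of_predictable hY.predictable).measurable
  have htm : Measurable fun z : ℝ × Ω => (z.1.toNNReal, z.2) := by fun_prop
  have hXm' : Measurable fun z : ℝ × Ω => X z.1.toNNReal z.2 := hXm.comp htm
  have hYm' : Measurable fun z : ℝ × Ω => Y z.1.toNNReal z.2 := hYm.comp htm
  have hX1 : ∀ t, Measurable (X t) := fun t => hXm.comp measurable_prodMk_left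
  have hY1 : ∀ t, Measurable (Y t) := fun t => hYm.comp measurable_prodMk_left
  set f : ℝ≥0 → ℝ≥0∞ := fun t => (∫⁻ ω, ‖X t ω - Y t ω‖ₑ ^ p ∂P) ^ (1 / p) with hf
  have hDm : Measurable fun z : ℝ × Ω => ‖X z.1.toNNReal z.2 - Y z.1.toNNReal z.2‖ₑ :=
    (hXm'.sub hYm').enorm
  have hfm : Measurable fun s : ℝ => f s.toNNReal :=
    ((hDm.pow_const p).lintegral_prod_right').pow_const _
  have hnorm : ∀ s, f s ≤ (∫⁻ ω, ‖X s ω‖ₑ ^ p ∂P) ^ (1 / p) + (∫⁻ ω, ‖Y s ω‖ₑ ^ p ∂P) ^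
      (1 / p) := by
    intro s
    have h1 := eLpNorm_sub_le (μ := P) (hX1 s).aestronglyMeasurable (hY1 s).aestronglyMeasurable
      (p := ENNReal.ofReal p) (by simpa using hp)
    rw [eLpNorm_ofReal_eq hp0, eLpNorm_ofReal_eq hp0, eLpNorm_ofReal_eq hp0] at h1
    exact h1
  have hint : ∫⁻ s in Icc (0 : ℝ) t, f s.toNNReal ≠ ∞ := by
    have hXn : Measurable fun s : ℝ => (∫⁻ ω, ‖X s.toNNReal ω‖ₑ ^ p ∂P) ^ (1 / p) :=
      ((hXm'.enorm.pow_const p).lintegral_prod_right').pow_const _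
    refine ne_top_of_le_ne_top ?_ (lintegral_mono fun s => hnorm s.toNNReal)
    rw [lintegral_add_left hXn]
    exact (ENNReal.add_lt_top.2 ⟨hXK t, hYK t⟩).ne
  -- the summand `1` keeps the constant positive when `C = 0`
  have hκ : (0 : ℝ) < 2 * C + 1 := by positivity
  have hgron : ∀ r ≤ t, f r ≤ 0 + ENNReal.ofReal (2 * C + 1) *
      ∫⁻ s in Icc (0 : ℝ) r, f s.toNNReal := by
    intro r _
    rw [zero_add, ← lintegral_const_mul' _ _ ENNReal.ofReal_ne_top]
    have hFm : Measurable (Function.uncurry fun (s : ℝ) (ω : Ω) =>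
        (C : ℝ≥0∞) * ‖X s.toNNReal ω - Y s.toNNReal ω‖ₑ + C * f s.toNNReal) :=
      (hDm.const_mul _).add ((hfm.comp measurable_fst).const_mul _)
    calc f r ≤ (∫⁻ ω, (∫⁻ s in Icc (0 : ℝ) r, ((C : ℝ≥0∞) * ‖X s.toNNReal ω - Y s.toNNReal ω‖ₑ +
            C * f s.toNNReal)) ^ p ∂P) ^ (1 / p) := by
          refine ENNReal.rpow_le_rpow (lintegral_mono_ae ?_) (by positivity)
          filter_upwards [hX.enorm_sub_le hB hS1 hY r] with ω hω
          exact ENNReal.rpow_le_rpow hω hp0.le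
      _ ≤ ∫⁻ s in Icc (0 : ℝ) r, (∫⁻ ω, ((C : ℝ≥0∞) * ‖X s.toNNReal ω - Y s.toNNReal ω‖ₑ +
            C * f s.toNNReal) ^ p ∂P) ^ (1 / p) := lintegral_lintegral_rpow_le hFm hp
      _ ≤ ∫⁻ s in Icc (0 : ℝ) r, ENNReal.ofReal (2 * C + 1) * f s.toNNReal := by
          refine lintegral_mono fun s => ?_
          have hD : Measurable fun ω => ‖X s.toNNReal ω - Y s.toNNReal ω‖ₑ :=
            ((hX1 _).sub (hY1 _)).enorm
          refine (ENNReal.lintegral_Lp_add_le (hD.const_mul (C : ℝ≥0∞)).aemeasurable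
            (measurable_const (a := C * f s.toNNReal)).aemeasurable hp).trans ?_
          simp_rw [ENNReal.mul_rpow_of_nonneg _ _ hp0.le]
          rw [lintegral_const_mul' _ _ (by finiteness), lintegral_const, measure_univ, mul_one,
            ENNReal.mul_rpow_of_nonneg _ _ (by positivity : 0 ≤ 1 / p),
            ENNReal.mul_rpow_of_nonneg _ _ (by positivity : 0 ≤ 1 / p), ← ENNReal.rpow_mul,
            ← ENNReal.rpow_mul, mul_one_div_cancel hp0.ne', ENNReal.rpow_one, ENNReal.rpow_one]
          change (C : ℝ≥0∞) * f s.toNNReal + C * f s.toNNReal ≤ _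
          rw [← add_mul]
          gcongr
          rw [← ENNReal.ofReal_coe_nnreal, ← ENNReal.ofReal_add C.coe_nonneg C.coe_nonneg]
          exact ENNReal.ofReal_le_ofReal (by linarith)
  have h0 := le_of_le_add_mul_lintegral hκ ENNReal.zero_ne_top hint hgron t le_rfl
  rw [mul_zero, zero_mul, nonpos_iff_eq_zero, hf] at h0
  have h1 : ∫⁻ ω, ‖X t ω - Y t ω‖ₑ ^ p ∂P = 0 := by
    rcases ENNReal.rpow_eq_zero_iff.1 h0 with h | h
    · exact h.1
    · exact absurd h.2 (by have := one_div_pos.2 hp0; linarith)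
  have hDt : Measurable fun ω => ‖X t ω - Y t ω‖ₑ := ((hX1 t).sub (hY1 t)).enorm
  rw [lintegral_eq_zero_iff (hDt.pow_const p)] at h1
  filter_upwards [h1] with ω hω
  have h2 : ‖X t ω - Y t ω‖ₑ = 0 := by simpa [hp0, hp0.le] using hω
  exact sub_eq_zero.1 (enorm_eq_zero.1 h2)

end Uniqueness

end McKeanVlasov

/-! ### Well-posedness and moment bounds -/

theorem theorem2p2 {H : Type*} [NormedAddCommGroup H] [InnerProductSpace ℝ H] [CompleteSpace H]
    [MeasurableSpace H] [BorelSpace H]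
    {Ω : Type*} [mΩ : MeasurableSpace Ω] (P : Measure Ω) [IsProbabilityMeasure P]
    (𝓕 : Filtration ℝ≥0 mΩ)
    (α p : ℝ) (hα : α ∈ Ioo 1 2) (hp : p ∈ Ico 1 α)
    (e : HilbertBasis ℕ ℝ H) (lam β : ℕ → ℝ)
    (A : H →ₗ.[ℝ] H) (S : ℝ≥0 → H →L[ℝ] H)
    (hA : IsSelfAdjoint A)
    (hAe : ∀ k, (e k, -lam k • e k) ∈ A.graph)
    (hlam_pos : ∀ k, 0 < lam k) (hlam_mono : Monotone lam) (hlam : Tendsto lam atTop atTop)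
    (hS : McKeanVlasov.IsSemigroupGeneratedBy S A)
    (hβ : ∀ k, 0 < β k)
    (hβlam : Summable fun k => β k ^ α / lam k)
    (L : ℕ → ℝ≥0 → Ω → ℝ) (hL : McKeanVlasov.IsCylindricalStable α 𝓕 P L)
    (B : H → McKeanVlasov.FiniteMomentMeasure H p → H)
    (hB : ∃ C : ℝ≥0, ∀ x y μ ν,
      ‖B x μ - B y ν‖ₑ ≤ C * (‖x - y‖ₑ + McKeanVlasov.wasserstein μ ν)) :
    (∀ ξ : Ω → H, StronglyMeasurable[𝓕 0] ξ → ∫⁻ ω, ‖ξ ω‖ₑ ^ p ∂P < ∞ →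
      ∃ X : ℝ≥0 → Ω → H,
        McKeanVlasov.IsMildSolution P 𝓕 p e lam β L S B ξ X ∧
        McKeanVlasov.HasIntegrableMoments P p X ∧
        ∀ Y : ℝ≥0 → Ω → H,
          McKeanVlasov.IsMildSolution P 𝓕 p e lam β L S B ξ Y →
          McKeanVlasov.HasIntegrableMoments P p Y → ∀ t, ∀ᵐ ω ∂P, Y t ω = X t ω) ∧
    (∀ m ∈ Ico p α, ∀ T : ℝ≥0, 0 < T → ∃ C : ℝ≥0, 0 < C ∧
      ∀ ξ : Ω → H, StronglyMeasurable[𝓕 0] ξ → ∫⁻ ω, ‖ξ ω‖ₑ ^ m ∂P < ∞ →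
      ∀ X : ℝ≥0 → Ω → H,
        McKeanVlasov.IsMildSolution P 𝓕 p e lam β L S B ξ X →
        McKeanVlasov.HasIntegrableMoments P p X →
        (⨆ t ∈ Icc 0 T, (∫⁻ ω, ‖X t ω‖ₑ ^ m ∂P) ^ (1 / m)) ≤
          C * (1 + (∫⁻ ω, ‖ξ ω‖ₑ ^ m ∂P) ^ (1 / m))) := by
  open McKeanVlasov in
  have hα0 : 0 < α := by linarith [hα.1]
  have := secondCountableTopology_of_hilbertBasis e
  have hp0 : 0 < p := by linarith [hp.1]
  have hS1 := hS.norm_apply_le e hAe hlam_pos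
  obtain ⟨C, hB⟩ := hB
  refine ⟨fun ξ hξ0 hξ => ?_, fun m hm T hT => ?_⟩
  · have : Fact (1 ≤ ENNReal.ofReal p) := ⟨ENNReal.one_le_ofReal.2 hp.1⟩
    obtain ⟨w, M, hw, -, hwad, hwZ⟩ :=
      exists_stochConvolution hα hp 𝓕 e hlam_pos hβ hβlam hL
    obtain ⟨X, u, hu, hXu, hX, -⟩ := exists_mildSolution hp0 le_rfl hB hS.continuous hS1 hw hwad
      hwZ hξ0 (memLp_of_lintegral_rpow_lt_top hp0 (hξ0.mono (𝓕.le 0)).aestronglyMeasurable hξ)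
    have hXK := hasIntegrableMoments_of_lp hp0 le_rfl hu hXu
    exact ⟨X, hX, hXK, fun Y hY hYK t => hY.ae_eq hp.1 hB hS1 hX hYK hXK t⟩
  · have hm1 : 1 ≤ m := hp.1.trans hm.1
    have hm0 : 0 < m := hp0.trans_le hm.1
    have : Fact (1 ≤ ENNReal.ofReal m) := ⟨ENNReal.one_le_ofReal.2 hm1⟩
    obtain ⟨w, M, hw, hM, hwad, hwZ⟩ :=
      exists_stochConvolution hα ⟨hm1, hm.2⟩ 𝓕 e hlam_pos hβ hβlam hL
    set b₀ : ℝ≥0 := ‖lpDrift (P := P) hp0 hm.1 hB 0‖₊ with hb₀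
    set E : ℝ≥0 := (Real.exp (2 * (2 * C + 1) * T)).toNNReal with hE
    have hE0 : 0 < E := Real.toNNReal_pos.2 (Real.exp_pos _)
    refine ⟨2 * (1 + M.toNNReal + T * b₀) * E, by positivity, fun ξ hξ0 hξ X hX hXK => ?_⟩
    have hξm := memLp_of_lintegral_rpow_lt_top hm0 (hξ0.mono (𝓕.le 0)).aestronglyMeasurable hξ
    obtain ⟨X', u, hu, hXu, hX', hueq⟩ := exists_mildSolution hp0 hm.1 hB hS.continuous hS1 hw hwad
      hwZ hξ0 hξm
    have hX'K := hasIntegrableMoments_of_lp hp0 hm.1 hu hXu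
    refine iSup₂_le fun t ht => ?_
    -- `X` inherits the `m`-th moments of the solution in `L^m` by uniqueness
    have hXu' : X t =ᵐ[P] u t :=
      EventuallyEq.trans (hX.ae_eq hp.1 hB hS1 hX' hXK hX'K t) (hXu t)
    have h1 := enorm_lp_solution_le hp0 hm.1 hB hS1 hM hξm hu hueq T t ht.2
    rw [← eLpNorm_ofReal_eq hm0, ← eLpNorm_ofReal_eq hm0, eLpNorm_congr_ae hXu', ← Lp.enorm_def]
    refine h1.trans ?_
    set x := eLpNorm ξ (ENNReal.ofReal m) P
    have h2 : x + ENNReal.ofReal M + T * ‖lpDrift (P := P) hp0 hm.1 hB 0‖ₑ ≤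
        (1 + ENNReal.ofReal M + T * b₀) * (1 + x) := by
      have h3 : ‖lpDrift (P := P) hp0 hm.1 hB 0‖ₑ = b₀ := rfl
      rw [h3]
      calc x + ENNReal.ofReal M + T * b₀
          ≤ x + ENNReal.ofReal M + T * b₀ + (1 + (ENNReal.ofReal M + T * b₀) * x) := le_self_add
        _ = _ := by ring
    calc _ ≤ 2 * ((1 + ENNReal.ofReal M + T * b₀) * (1 + x)) * E := by
          gcongr
          rfl
      _ = _ := by
          push_cast
          rw [ENNReal.ofReal]
          ring
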